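/- Let $f:\mathbb{Z}\to[0,\infty)$. The wedge comb $\mathrm{Comb}(\mathbb{Z},f)$ is the graph with vertex set $\{(x,y)\in\mathbb{Z}^2: -f(x)\le y\le f(x)\}$, in which $(x,n)$ and $(x,m)$ are joined by an edge whenever $|m-n|=1$, and $(x,0)$ and $(y,0)$ are joined by an edge whenever $|x-y|=1$. A simple random walk on this graph is the Markov chain that at each step jumps from the current vertex to one of its neighbours, each chosen with equal probability. Let $\breve f(n)=1\vee\max_{-n\le i\le n}f(i)$. If $$\sum_{n=1}^{\infty}\frac{1}{\breve f(n)}=\infty,$$ then any two independent simple random walks $X=(X_n)_{n\ge0}$ and $X'=(X'_n)_{n\ge0}$ on $\mathrm{Comb}(\mathbb{Z},f)$ starting from the same vertex collide infinitely many times with probability one, that is, $|\{n\ge0: X_n=X'_n\}|=\infty$ almost surely. -/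

import Mathlib

open MeasureTheory ProbabilityTheory Filter

/-- The vertex set `{(x, y) ∈ ℤ × ℤ : -f x ≤ y ≤ f x}` of the wedge comb with profile `f`. -/
abbrev CombVertex (f : ℤ → ℝ) : Type :=
  {p : ℤ × ℤ // -f p.1 ≤ (p.2 : ℝ) ∧ (p.2 : ℝ) ≤ f p.1}

/-- The wedge comb `Comb(ℤ, f)`: vertical edges between consecutive vertices of a column, and
horizontal edges between consecutive vertices of the axis `y = 0`. -/
def Comb (f : ℤ → ℝ) : SimpleGraph (CombVertex f) where
  Adj p q :=
    (p.1.1 = q.1.1 ∧ |p.1.2 - q.1.2| = 1) ∨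
      (p.1.2 = 0 ∧ q.1.2 = 0 ∧ |p.1.1 - q.1.1| = 1)
  symm := ⟨fun p q h => by
    rcases h with ⟨h1, h2⟩ | ⟨h1, h2, h3⟩
    · exact Or.inl ⟨h1.symm, by rwa [abs_sub_comm]⟩
    · exact Or.inr ⟨h2, h1, by rwa [abs_sub_comm]⟩⟩
  loopless := ⟨fun p h => by simp at h⟩

theorem Comb.finite_neighborSet (f : ℤ → ℝ) (p : CombVertex f) :
    ((Comb f).neighborSet p).Finite := by
  refine Set.Finite.subset (Set.Finite.preimage Subtype.val_injective.injOn
    (((Set.finite_Icc (p.1.1 - 1) (p.1.1 + 1)).prod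
      (Set.finite_Icc (p.1.2 - 1) (p.1.2 + 1))))) ?_
  intro q hq
  rw [SimpleGraph.mem_neighborSet] at hq
  simp only [Set.mem_preimage, Set.mem_prod, Set.mem_Icc]
  rcases hq with ⟨h1, h2⟩ | ⟨h1, h2, h3⟩ <;> grind

noncomputable instance Comb.instLocallyFinite (f : ℤ → ℝ) : (Comb f).LocallyFinite :=
  fun p => (Comb.finite_neighborSet f p).fintype

open scoped Classical in
/-- One-step transition probability of the simple random walk on a locally finite graph:
a neighbour is chosen with equal probability. -/
noncomputable def srwStep {V : Type*} (G : SimpleGraph V) [G.LocallyFinite] (u w : V) : ENNReal :=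
  if G.Adj u w then ((G.degree u : ℕ) : ENNReal)⁻¹ else 0

/-- Under `P`, the process `X` is a simple random walk on `G` started at `v`: the Markov chain with
initial state `v` and transition probabilities `srwStep G`. The Markov property is expressed
through the probabilities of finite initial paths. -/
structure IsSimpleRandomWalk {V : Type*} [MeasurableSpace V] (G : SimpleGraph V) [G.LocallyFinite]
    {Ω : Type*} [MeasurableSpace Ω] (P : Measure Ω) (v : V) (X : ℕ → Ω → V) : Prop where
  measurable : ∀ n, Measurable (X n)
  initial : ∀ᵐ ω ∂P, X 0 ω = v
  markov : ∀ (n : ℕ) (x : ℕ → V),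
    P {ω | ∀ i ≤ n + 1, X i ω = x i} =
      P {ω | ∀ i ≤ n, X i ω = x i} * srwStep G (x n) (x (n + 1))

/-- `1 ∨ max_{-n ≤ i ≤ n} f i`. -/
noncomputable def runningMax (f : ℤ → ℝ) (n : ℕ) : ℝ :=
  max 1 ((Finset.Icc (-(n : ℤ)) (n : ℤ)).sup' (Finset.nonempty_Icc.mpr (by lia)) f)

/-! Collisions are counted scale by scale. At scale `n = 64 ^ k`, count the collisions that happen
at height at most `64 n`, after both walks have left the columns `[-n, n]` and before either leaves
`[-64 n, 64 n]`. Let `Y k` be this number divided by `64 n`. If the walks met only finitely often,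
`∑ Y k` would be finite, since the normalisations grow geometrically; so it suffices that `∑ Y k`
diverges almost surely, which follows from Chebyshev's inequality and two estimates.

Means. By reversibility, expected collisions are comparable to Green functions, which the explicit
potential of a unit flow on the comb bounds independently of the teeth (`sum_killedKernel_box_le`,
`eventually_le_sum_killedKernel_box`). So a level has expected energy at least `n` before the height
cap (`eventually_le_shellEnergy`). Along a tooth the summed squared densities are convex and do not
increase at the tips, so on a folded tooth they decrease away from the axis. Hence the low part
keeps a share of order `min 1 (n / runningMax)` (`shellEnergy_le_lowBox`). The divergence
hypothesis, condensed along powers of 64, says that these shares have infinite sum.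

Correlations. After a collision at a vertex `u` of an earlier level, with column and height at most
`j`, later collisions at scale `n` are governed by the energy from `u`. The square root of this
energy is subharmonic by Minkowski's inequality and of order `√n` at the exit points. Comparison
with the potential shows that it exceeds its value at the starting vertex by `O(√n * j / n)`
(`sqrt_shellEnergy_lowBox_le`). Thus the energies differ by `O(j)` (`levelEnergy_le_add`), the
excess correlations decay geometrically in the separation of levels, and the variance of `∑ Y k` is
bounded by a constant times its mean (`measure_forall_sum_le_eq_zero`). -/

/-! ### Killed random walks, Green functions and collision energies on a general graph. -/

section KilledWalk

namespace SimpleGraph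

variable {V : Type*} (G : SimpleGraph V) [G.LocallyFinite]

/-- The average of a function over the neighbours of a vertex. -/
noncomputable def nbrAvg (F : V → ℝ) (u : V) : ℝ :=
  (∑ w ∈ G.neighborFinset u, F w) / G.degree u

open scoped Classical in
/-- The `t`-step transition probabilities of the simple random walk on `G` killed on leaving `B`. -/
noncomputable def killedKernel (B : Finset V) : ℕ → V → V → ℝ
  | 0, u, z => if u ∈ B ∧ u = z then 1 else 0
  | t + 1, u, z => if u ∈ B then G.nbrAvg (fun w => killedKernel B t w z) u else 0

variable {G}

theorem nbrAvg_mono {F H : V → ℝ} {u : V} (h : ∀ w, G.Adj u w → F w ≤ H w) :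
    G.nbrAvg F u ≤ G.nbrAvg H u :=
  div_le_div_of_nonneg_right
    (Finset.sum_le_sum fun w hw => h w ((G.mem_neighborFinset u w).1 hw)) (Nat.cast_nonneg _)

theorem nbrAvg_congr {F H : V → ℝ} {u : V} (h : ∀ w, G.Adj u w → F w = H w) :
    G.nbrAvg F u = G.nbrAvg H u :=
  le_antisymm (nbrAvg_mono fun w hw => (h w hw).le) (nbrAvg_mono fun w hw => (h w hw).ge)

theorem nbrAvg_nonneg {F : V → ℝ} {u : V} (h : ∀ w, G.Adj u w → 0 ≤ F w) :
    0 ≤ G.nbrAvg F u :=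
  div_nonneg (Finset.sum_nonneg fun w hw => h w ((G.mem_neighborFinset u w).1 hw))
    (Nat.cast_nonneg _)

theorem nbrAvg_sum {ι : Type*} (s : Finset ι) (F : ι → V → ℝ) (u : V) :
    G.nbrAvg (fun w => ∑ i ∈ s, F i w) u = ∑ i ∈ s, G.nbrAvg (F i) u := by
  simp only [nbrAvg]
  rw [Finset.sum_comm, Finset.sum_div]

theorem nbrAvg_add (F H : V → ℝ) (u : V) :
    G.nbrAvg (fun w => F w + H w) u = G.nbrAvg F u + G.nbrAvg H u := by
  simp only [nbrAvg, Finset.sum_add_distrib, add_div]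

theorem nbrAvg_sub (F H : V → ℝ) (u : V) :
    G.nbrAvg (fun w => F w - H w) u = G.nbrAvg F u - G.nbrAvg H u := by
  simp only [nbrAvg, Finset.sum_sub_distrib, sub_div]

theorem nbrAvg_mul_right (F : V → ℝ) (c : ℝ) (u : V) :
    G.nbrAvg (fun w => F w * c) u = G.nbrAvg F u * c := by
  simp only [nbrAvg, ← Finset.sum_mul]; ring

theorem degree_ne_zero_of_adj {u w : V} (h : G.Adj u w) : (G.degree u : ℝ) ≠ 0 := by
  have : 0 < G.degree u := (G.degree_pos_iff_exists_adj u).2 ⟨w, h⟩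
  positivity

theorem nbrAvg_const {u : V} (hu : 0 < G.degree u) (c : ℝ) : G.nbrAvg (fun _ => c) u = c := by
  have : (G.degree u : ℝ) ≠ 0 := by positivity
  simp only [nbrAvg, Finset.sum_const, nsmul_eq_mul, card_neighborFinset_eq_degree]
  field_simp

/-- The triangle inequality for the square root of a finite sum of squares of averages. -/
theorem sqrt_sum_sq_nbrAvg_le {ι : Type*} (s : Finset ι) (F : ι → V → ℝ) (u : V) :
    √(∑ i ∈ s, (G.nbrAvg (F i) u) ^ 2) ≤ G.nbrAvg (fun w => √(∑ i ∈ s, (F i w) ^ 2)) u := by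
  have key : ∀ N : Finset V, √(∑ i ∈ s, (∑ w ∈ N, F i w) ^ 2) ≤
      ∑ w ∈ N, √(∑ i ∈ s, (F i w) ^ 2) := by
    intro N
    have := norm_sum_le N
      (fun w => (WithLp.toLp 2 (fun i : s => F i w) : EuclideanSpace ℝ s))
    simp only [EuclideanSpace.norm_eq, Real.norm_eq_abs, sq_abs, WithLp.ofLp_sum,
      Finset.sum_apply] at this
    have e : ∀ g : ι → ℝ, ∑ i : s, g i = ∑ i ∈ s, g i := fun g => Finset.sum_coe_sort s g
    rw [e (fun i => (∑ w ∈ N, F i w) ^ 2)] at this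
    refine this.trans (le_of_eq (Finset.sum_congr rfl fun w _ => ?_))
    rw [e (fun i => (F i w) ^ 2)]
  simp only [nbrAvg, div_pow]
  rw [← Finset.sum_div, Real.sqrt_div' _ (sq_nonneg _), Real.sqrt_sq (Nat.cast_nonneg _)]
  exact div_le_div_of_nonneg_right (key _) (Nat.cast_nonneg _)

variable {B C : Finset V}

theorem killedKernel_zero_self {u : V} (hu : u ∈ B) : G.killedKernel B 0 u u = 1 := by
  simp [killedKernel, hu]

theorem killedKernel_zero_ne {u z : V} (h : u ≠ z) : G.killedKernel B 0 u z = 0 := by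
  simp [killedKernel, h]

theorem killedKernel_succ {u : V} (hu : u ∈ B) (t : ℕ) (z : V) :
    G.killedKernel B (t + 1) u z = G.nbrAvg (fun w => G.killedKernel B t w z) u := by
  simp [killedKernel, hu]

theorem killedKernel_of_notMem_left {u : V} (hu : u ∉ B) (t : ℕ) (z : V) :
    G.killedKernel B t u z = 0 := by
  cases t <;> simp [killedKernel, hu]

theorem killedKernel_of_notMem_right {z : V} (hz : z ∉ B) (t : ℕ) (u : V) :
    G.killedKernel B t u z = 0 := by
  induction t generalizing u with
  | zero => 
    simp only [killedKernel, ite_eq_right_iff, one_ne_zero, imp_false, not_and]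
    rintro h rfl; exact hz h
  | succ t ih => simp [killedKernel, ih, nbrAvg]

theorem killedKernel_nonneg (t : ℕ) (u z : V) : 0 ≤ G.killedKernel B t u z := by
  induction t generalizing u with
  | zero => simp only [killedKernel]; split_ifs <;> norm_num
  | succ t ih =>
    simp only [killedKernel]; split_ifs
    · exact nbrAvg_nonneg fun w _ => ih w
    · exact le_rfl

theorem killedKernel_mono (h : B ⊆ C) (t : ℕ) (u z : V) :
    G.killedKernel B t u z ≤ G.killedKernel C t u z := by
  by_cases hu : u ∈ B
  swap
  · rw [killedKernel_of_notMem_left hu]; exact killedKernel_nonneg _ _ _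
  induction t generalizing u with
  | zero =>
    by_cases hz : u = z
    · subst hz; rw [killedKernel_zero_self hu, killedKernel_zero_self (h hu)]
    · rw [killedKernel_zero_ne hz, killedKernel_zero_ne hz]
  | succ t ih =>
    rw [killedKernel_succ hu, killedKernel_succ (h hu)]
    refine nbrAvg_mono fun w _ => ?_
    by_cases hw : w ∈ B
    · exact ih w hw
    · rw [killedKernel_of_notMem_left hw]; exact killedKernel_nonneg _ _ _

/-- The forward recursion for the killed kernel. -/
theorem killedKernel_succ' {z : V} (hz : z ∈ B) (t : ℕ) (u : V) :
    G.killedKernel B (t + 1) u z =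
      ∑ w ∈ G.neighborFinset z, G.killedKernel B t u w / G.degree w := by
  classical
  by_cases hu : u ∈ B
  swap
  · simp [killedKernel_of_notMem_left hu]
  induction t generalizing u with
  | zero =>
    rw [killedKernel_succ hu]
    have h1 : ∀ w, G.killedKernel B 0 w z = if w = z then 1 else 0 := by
      intro w
      by_cases h : w = z
      · subst h; simp [killedKernel_zero_self hz]
      · simp [killedKernel_zero_ne h, h]
    have h2 : ∀ w, G.killedKernel B 0 u w = if u = w then 1 else 0 := by
      intro w
      by_cases h : u = w
      · subst h; simp [killedKernel_zero_self hu]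
      · simp [killedKernel_zero_ne h, h]
    simp only [h1, h2, nbrAvg, ite_div, zero_div, Finset.sum_ite_eq, Finset.sum_ite_eq',
      mem_neighborFinset, G.adj_comm z u]
  | succ t ih =>
    rw [killedKernel_succ hu]
    have h3 : ∀ w, G.killedKernel B (t + 1) w z =
        ∑ y ∈ G.neighborFinset z, G.killedKernel B t w y * (1 / G.degree y) := by
      intro w
      by_cases hw : w ∈ B
      · rw [ih w hw]; simp [div_eq_mul_inv]
      · simp [killedKernel_of_notMem_left hw]
    simp only [h3]
    rw [nbrAvg_sum]
    refine Finset.sum_congr rfl fun y _ => ?_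
    rw [nbrAvg_mul_right, killedKernel_succ hu]; ring

/-- Detailed balance: reversing a path exchanges only the degrees of its two endpoints. -/
theorem degree_mul_killedKernel (t : ℕ) (u z : V) :
    G.degree u * G.killedKernel B t u z = G.degree z * G.killedKernel B t z u := by
  by_cases hu : u ∈ B
  swap
  · simp [killedKernel_of_notMem_left hu, killedKernel_of_notMem_right hu]
  by_cases hz : z ∈ B
  swap
  · simp [killedKernel_of_notMem_left hz, killedKernel_of_notMem_right hz]
  induction t generalizing u z with
  | zero =>
    by_cases h : u = z
    · subst h; rfl
    · simp [killedKernel_zero_ne h, killedKernel_zero_ne (Ne.symm h)]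
  | succ t ih =>
    rw [killedKernel_succ hu, killedKernel_succ' hu, Finset.mul_sum]
    have h1 : ∀ w ∈ G.neighborFinset u,
        (G.degree z : ℝ) * (G.killedKernel B t z w / G.degree w) = G.killedKernel B t w z := by
      intro w hw
      have hd := degree_ne_zero_of_adj (((G.mem_neighborFinset u w).1 hw).symm)
      by_cases hwB : w ∈ B
      · rw [← mul_div_assoc, ← ih w z hwB hz]; field_simp
      · simp [killedKernel_of_notMem_left hwB, killedKernel_of_notMem_right hwB]
    rw [Finset.sum_congr rfl h1, nbrAvg]
    by_cases hd : (G.degree u : ℝ) = 0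
    · have : G.neighborFinset u = ∅ := by
        rw [← Finset.card_eq_zero, card_neighborFinset_eq_degree]; exact_mod_cast hd
      simp [this]
    · field_simp

theorem sum_killedKernel_mul (s t : ℕ) (u w : V) :
    ∑ z ∈ B, G.killedKernel B s u z * G.killedKernel B t z w = G.killedKernel B (s + t) u w := by
  by_cases hu : u ∈ B
  swap
  · simp [killedKernel_of_notMem_left hu]
  induction s generalizing u with
  | zero =>
    rw [Finset.sum_eq_single_of_mem u hu, killedKernel_zero_self hu, one_mul, zero_add]
    intro b _ hb
    rw [killedKernel_zero_ne hb.symm, zero_mul]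
  | succ s ih =>
    rw [show s + 1 + t = (s + t) + 1 by ring, killedKernel_succ hu]
    simp only [killedKernel_succ hu]
    simp only [← nbrAvg_mul_right]
    rw [← nbrAvg_sum]
    refine nbrAvg_congr fun x _ => ?_
    by_cases hx : x ∈ B
    · exact ih x hx
    · simp [killedKernel_of_notMem_left hx]

/-- Reversibility turns two walks meeting at `z` into one loop from `u` through `z`, linking
collisions to returns. -/
theorem degree_mul_sum_sq (t : ℕ) (u : V) :
    G.degree u * ∑ z ∈ B, G.killedKernel B t u z ^ 2 =
      ∑ z ∈ B, G.degree z * (G.killedKernel B t u z * G.killedKernel B t z u) := by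
  rw [Finset.mul_sum]
  refine Finset.sum_congr rfl fun z _ => ?_
  have := degree_mul_killedKernel (G := G) (B := B) t u z
  linear_combination G.killedKernel B t u z * this

/-- Comparison of the Green function with a superharmonic function. -/
theorem sum_killedKernel_le {Ψ : V → ℝ} {z : V} (h0 : ∀ u ∈ B, 0 ≤ Ψ u)
    (h1 : ∀ u ∈ B, ∀ w, G.Adj u w → 0 ≤ Ψ w)
    (h2 : ∀ u ∈ B, u ≠ z → G.nbrAvg Ψ u ≤ Ψ u) (h3 : G.nbrAvg Ψ z + 1 ≤ Ψ z)
    (T : ℕ) {u : V} (hu : u ∈ B) : ∑ t ∈ Finset.range T, G.killedKernel B t u z ≤ Ψ u := by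
  induction T generalizing u with
  | zero => simpa using h0 u hu
  | succ T ih =>
    rw [Finset.sum_range_succ']
    simp only [killedKernel_succ hu]
    rw [← nbrAvg_sum]
    have key : G.nbrAvg (fun w => ∑ t ∈ Finset.range T, G.killedKernel B t w z) u ≤
        G.nbrAvg Ψ u := by
      refine nbrAvg_mono fun w hw => ?_
      by_cases hwB : w ∈ B
      · exact ih hwB
      · simpa [killedKernel_of_notMem_left hwB] using h1 u hu w hw
    by_cases huz : u = z
    -- The unit defect of `Ψ` at `z` pays for the visit at time `0`.
    · subst huz; rw [killedKernel_zero_self hu]; linarith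
    · rw [killedKernel_zero_ne huz]; linarith [h2 u hu huz]

/-- Comparison of the Green function with a subharmonic function. -/
theorem le_sum_killedKernel_add {Ψ : V → ℝ} {z : V}
    (h1 : ∀ u ∈ B, ∀ w, w ∉ B → G.Adj u w → Ψ w ≤ 0)
    (h2 : ∀ u ∈ B, u ≠ z → Ψ u ≤ G.nbrAvg Ψ u) (h3 : Ψ z ≤ G.nbrAvg Ψ z + 1)
    (T : ℕ) {u : V} (hu : u ∈ B) :
    Ψ u ≤ ∑ t ∈ Finset.range T, G.killedKernel B t u z +
      ∑ y ∈ B, G.killedKernel B T u y * Ψ y := by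
  induction T generalizing u with
  | zero =>
    rw [Finset.sum_eq_single_of_mem u hu]
    · simp [killedKernel_zero_self hu]
    · intro b _ hb; rw [killedKernel_zero_ne hb.symm, zero_mul]
  | succ T ih =>
    rw [Finset.sum_range_succ']
    simp only [killedKernel_succ hu, ← nbrAvg_mul_right]
    rw [← nbrAvg_sum, ← nbrAvg_sum, add_right_comm, ← nbrAvg_add]
    have key : G.nbrAvg Ψ u ≤ G.nbrAvg (fun w => ∑ t ∈ Finset.range T, G.killedKernel B t w z +
        ∑ y ∈ B, G.killedKernel B T w y * Ψ y) u := by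
      refine nbrAvg_mono fun w hw => ?_
      by_cases hwB : w ∈ B
      · exact ih hwB
      · simpa [killedKernel_of_notMem_left hwB] using h1 u hu w hwB hw
    by_cases huz : u = z
    · subst huz; rw [killedKernel_zero_self hu]; linarith
    · rw [killedKernel_zero_ne huz]; linarith [h2 u hu huz]

/-- The probability of surviving in `B` tends to zero once the Green function is finite. -/
theorem tendsto_sum_killedKernel_mul {u : V} (Ψ : V → ℝ)
    (h : ∀ y ∈ B, ∃ c, ∀ T, ∑ t ∈ Finset.range T, G.killedKernel B t u y ≤ c) :
    Tendsto (fun T => ∑ y ∈ B, G.killedKernel B T u y * Ψ y) atTop (nhds 0) := by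
  rw [← Finset.sum_const_zero (s := B)]
  refine tendsto_finsetSum _ fun y hy => ?_
  obtain ⟨c, hc⟩ := h y hy
  have hs : Summable fun t => G.killedKernel B t u y :=
    summable_of_sum_range_le (fun t => killedKernel_nonneg t u y) hc
  simpa using hs.tendsto_atTop_zero.mul_const (Ψ y)

/-- Partial sums of the collision counts are comparable to the Green function: upper bound. -/
theorem sum_sum_sq_le {D : ℝ} (hD : ∀ z : V, (G.degree z : ℝ) ≤ D) {u : V}
    (hu : 1 ≤ G.degree u) (T : ℕ) :
    ∑ t ∈ Finset.range T, ∑ z ∈ B, G.killedKernel B t u z ^ 2 ≤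
      D * ((∑ t ∈ Finset.range (2 * T), G.killedKernel B t u u) / G.degree u) := by
  have hu' : (0 : ℝ) < G.degree u := by exact_mod_cast hu
  have hD0 : 0 ≤ D := hu'.le.trans (hD u)
  rw [← mul_div_assoc, le_div_iff₀' hu', Finset.mul_sum]
  have h1 : ∀ t, G.degree u * ∑ z ∈ B, G.killedKernel B t u z ^ 2 ≤
      D * G.killedKernel B (2 * t) u u := by
    intro t
    rw [degree_mul_sum_sq, two_mul, ← sum_killedKernel_mul, Finset.mul_sum]
    exact Finset.sum_le_sum fun z _ => mul_le_mul_of_nonneg_right (hD z)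
      (mul_nonneg (killedKernel_nonneg _ _ _) (killedKernel_nonneg _ _ _))
  refine (Finset.sum_le_sum fun t _ => h1 t).trans ?_
  rw [← Finset.mul_sum]
  refine mul_le_mul_of_nonneg_left ?_ hD0
  rw [Finset.range_eq_Ico, ← Finset.sum_image (f := fun s => G.killedKernel B s u u)
    (g := fun t => 2 * t) (fun a _ b _ h => by simpa using h)]
  refine Finset.sum_le_sum_of_subset_of_nonneg ?_ fun _ _ _ => killedKernel_nonneg _ _ _
  intro s hs
  simp only [Finset.mem_image, Finset.mem_Ico, Finset.mem_range] at hs ⊢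
  omega

/-- Partial sums of the collision counts are comparable to the Green function: lower bound, when
returns take an even time. -/
theorem le_sum_sum_sq (hd : ∀ z : V, 1 ≤ G.degree z) {u : V}
    (hodd : ∀ t, G.killedKernel B (2 * t + 1) u u = 0) (T : ℕ) :
    (∑ t ∈ Finset.range (2 * T), G.killedKernel B t u u) / G.degree u ≤
      ∑ t ∈ Finset.range T, ∑ z ∈ B, G.killedKernel B t u z ^ 2 := by
  have hu' : (0 : ℝ) < G.degree u := by exact_mod_cast hd u
  rw [div_le_iff₀' hu', Finset.mul_sum]
  have h1 : ∀ t, G.killedKernel B (2 * t) u u ≤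
      G.degree u * ∑ z ∈ B, G.killedKernel B t u z ^ 2 := by
    intro t
    rw [degree_mul_sum_sq, two_mul, ← sum_killedKernel_mul]
    exact Finset.sum_le_sum fun z _ => le_mul_of_one_le_left
      (mul_nonneg (killedKernel_nonneg _ _ _) (killedKernel_nonneg _ _ _))
      (by exact_mod_cast hd z)
  refine le_trans (le_of_eq ?_) (Finset.sum_le_sum fun t _ => h1 t)
  induction T with
  | zero => simp
  | succ T ih =>
    rw [show 2 * (T + 1) = 2 * T + 1 + 1 by ring, Finset.sum_range_succ, Finset.sum_range_succ,
      Finset.sum_range_succ, ih, hodd, add_zero]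

variable (G) in
/-- The probability that the simple random walk from `u` is at `z` at time `t`, has stayed in `C`
and has left `B` by that time. -/
noncomputable def shellKernel (B C : Finset V) (t : ℕ) (u z : V) : ℝ :=
  G.killedKernel C t u z - G.killedKernel B t u z

theorem shellKernel_nonneg (h : B ⊆ C) (t : ℕ) (u z : V) : 0 ≤ G.shellKernel B C t u z :=
  sub_nonneg.2 (killedKernel_mono h t u z)

theorem shellKernel_le (t : ℕ) (u z : V) :
    G.shellKernel B C t u z ≤ G.killedKernel C t u z :=
  sub_le_self _ (killedKernel_nonneg t u z)

theorem shellKernel_zero (h : B ⊆ C) {u : V} (hu : u ∈ B) (z : V) :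
    G.shellKernel B C 0 u z = 0 := by
  by_cases hz : u = z
  · subst hz; rw [shellKernel, killedKernel_zero_self hu, killedKernel_zero_self (h hu), sub_self]
  · rw [shellKernel, killedKernel_zero_ne hz, killedKernel_zero_ne hz, sub_self]

theorem shellKernel_succ (h : B ⊆ C) {u : V} (hu : u ∈ B) (t : ℕ) (z : V) :
    G.shellKernel B C (t + 1) u z = G.nbrAvg (fun w => G.shellKernel B C t w z) u := by
  simp only [shellKernel]
  rw [killedKernel_succ hu, killedKernel_succ (h hu), nbrAvg_sub]

/-- The condition `hB` excludes points just outside `B`, where the kernel killed on leaving `B`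
vanishes although mass flows in from a neighbour. -/
theorem shellKernel_succ' {z : V} (hz : z ∈ C) (hB : z ∉ B → ∀ w, G.Adj z w → w ∉ B)
    (t : ℕ) (u : V) :
    G.shellKernel B C (t + 1) u z =
      ∑ w ∈ G.neighborFinset z, G.shellKernel B C t u w / G.degree w := by
  simp only [shellKernel, sub_div, Finset.sum_sub_distrib]
  rw [killedKernel_succ' hz]
  congr 1
  by_cases hzB : z ∈ B
  · exact killedKernel_succ' hzB t u
  · rw [killedKernel_of_notMem_right hzB, Finset.sum_eq_zero]
    intro w hw
    rw [killedKernel_of_notMem_right (hB hzB w ((G.mem_neighborFinset z w).1 hw)), zero_div]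

variable (G) in
/-- The expected number of common visits to `S` before time `T` of two independent copies of the
walk from `u`, counted while both are in `C` but have left `B`. -/
noncomputable def shellEnergy (B C S : Finset V) (T : ℕ) (u : V) : ℝ :=
  ∑ t ∈ Finset.range T, ∑ z ∈ S, G.shellKernel B C t u z ^ 2

theorem shellEnergy_nonneg (S : Finset V) (T : ℕ) (u : V) : 0 ≤ G.shellEnergy B C S T u :=
  Finset.sum_nonneg fun _ _ => Finset.sum_nonneg fun _ _ => sq_nonneg _

theorem shellEnergy_mono (S : Finset V) {T T' : ℕ} (h : T ≤ T') (u : V) :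
    G.shellEnergy B C S T u ≤ G.shellEnergy B C S T' u :=
  Finset.sum_le_sum_of_subset_of_nonneg (Finset.range_subset_range.2 h)
    fun _ _ _ => Finset.sum_nonneg fun _ _ => sq_nonneg _

theorem shellEnergy_le {S : Finset V} (hBC : B ⊆ C) (hS : S ⊆ C) (T : ℕ) (u : V) :
    G.shellEnergy B C S T u ≤
      ∑ t ∈ Finset.range T, ∑ z ∈ C, G.killedKernel C t u z ^ 2 := by
  refine Finset.sum_le_sum fun t _ => ?_
  refine (Finset.sum_le_sum_of_subset_of_nonneg hS fun _ _ _ => sq_nonneg _).trans ?_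
  exact Finset.sum_le_sum fun z _ =>
    pow_le_pow_left₀ (shellKernel_nonneg hBC _ _ _) (shellKernel_le _ _ _) 2

/-- Termwise this is `(a - b) ^ 2 ≥ a ^ 2 / 2 - b ^ 2`. -/
theorem le_shellEnergy (hBC : B ⊆ C) (T : ℕ) (u : V) :
    (∑ t ∈ Finset.range T, ∑ z ∈ C, G.killedKernel C t u z ^ 2) / 2 -
      ∑ t ∈ Finset.range T, ∑ z ∈ B, G.killedKernel B t u z ^ 2 ≤
      G.shellEnergy B C C T u := by
  rw [shellEnergy, Finset.sum_div, ← Finset.sum_sub_distrib]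
  refine Finset.sum_le_sum fun t _ => ?_
  have : ∑ z ∈ B, G.killedKernel B t u z ^ 2 = ∑ z ∈ C, G.killedKernel B t u z ^ 2 :=
    Finset.sum_subset hBC fun z _ hz => by rw [killedKernel_of_notMem_right hz]; norm_num
  rw [this, Finset.sum_div, ← Finset.sum_sub_distrib]
  refine Finset.sum_le_sum fun z _ => ?_
  rw [shellKernel]
  nlinarith [sq_nonneg (G.killedKernel C t u z - 2 * G.killedKernel B t u z)]

/-- Nothing is counted at time `0` from inside `B`, so one step can be averaged over; by Minkowski's
inequality the root of the energy is subharmonic there. -/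
theorem sqrt_shellEnergy_succ_le (hBC : B ⊆ C) (S : Finset V) (T : ℕ) {u : V} (hu : u ∈ B) :
    √(G.shellEnergy B C S (T + 1) u) ≤ G.nbrAvg (fun w => √(G.shellEnergy B C S T w)) u := by
  have h := sqrt_sum_sq_nbrAvg_le (G := G) (Finset.range T ×ˢ S)
    (fun p w => G.shellKernel B C p.1 w p.2) u
  simp only [Finset.sum_product] at h
  refine le_trans (le_of_eq ?_) h
  congr 1
  rw [shellEnergy, Finset.sum_range_succ']
  simp only [shellKernel_zero hBC hu, shellKernel_succ hBC hu]
  simp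

/-- The energy from `u` exceeds the energy from `v` by at most an error controlled by a
superharmonic function vanishing at `v` that dominates on the outer boundary of `B`. -/
theorem sqrt_shellEnergy_le (hBC : B ⊆ C) (S : Finset V) {v : V} {φ : V → ℝ} {T : ℕ}
    (h0 : ∀ u ∈ B, 0 ≤ φ u) (hdeg : ∀ u ∈ B, 0 < G.degree u)
    (h1 : ∀ u ∈ B, u ≠ v → G.nbrAvg φ u ≤ φ u)
    (h2 : ∀ u ∈ B, ∀ w, w ∉ B → G.Adj u w → √(G.shellEnergy B C S T w) ≤ φ w)
    {u : V} (hu : u ∈ B) :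
    √(G.shellEnergy B C S T u) ≤ √(G.shellEnergy B C S T v) + φ u := by
  suffices H : ∀ T' ≤ T, ∀ u ∈ B,
      √(G.shellEnergy B C S T' u) ≤ √(G.shellEnergy B C S T v) + φ u from H T le_rfl u hu
  intro T'
  induction T' with
  | zero =>
    intro _ u hu
    have := h0 u hu
    simp only [shellEnergy, Finset.range_zero, Finset.sum_empty, Real.sqrt_zero]
    positivity
  | succ T' ih =>
    intro hT' u hu
    -- At `v` the bound is trivial, so `φ` may fail to be superharmonic there.
    by_cases huv : u = v
    · subst huv
      exact (Real.sqrt_le_sqrt (shellEnergy_mono S hT' _)).trans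
        (le_add_of_nonneg_right (h0 u hu))
    refine (sqrt_shellEnergy_succ_le hBC S T' hu).trans ?_
    have h3 : G.nbrAvg (fun w => √(G.shellEnergy B C S T' w)) u ≤
        G.nbrAvg (fun w => √(G.shellEnergy B C S T v) + φ w) u := by
      refine nbrAvg_mono fun w hw => ?_
      by_cases hwB : w ∈ B
      · exact ih (by omega) w hwB
      · refine (Real.sqrt_le_sqrt (shellEnergy_mono S (by omega) w)).trans ((h2 u hu w hwB hw).trans ?_)
        exact le_add_of_nonneg_left (Real.sqrt_nonneg _)
    rw [nbrAvg_add, nbrAvg_const (hdeg u hu)] at h3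
    linarith [h1 u hu huv]

end SimpleGraph

end KilledWalk

/-! ### The flow potential on the comb and Green function bounds in boxes. -/

section CombGeometry

namespace Comb

variable {f : ℤ → ℝ}

theorem mem_iff (p : ℤ × ℤ) :
    (-f p.1 ≤ (p.2 : ℝ) ∧ (p.2 : ℝ) ≤ f p.1) ↔ |p.2| ≤ ⌊f p.1⌋ := by
  rw [Int.le_floor, Int.cast_abs, abs_le]

theorem abs_le_floor (u : CombVertex f) : |u.1.2| ≤ ⌊f u.1.1⌋ := (mem_iff u.1).1 u.2

open scoped Classical in
-- Since `Φ` vanishes off the comb, missing vertical neighbours need no separate case.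
theorem sum_neighborFinset {Φ : ℤ × ℤ → ℝ} (hΦ : ∀ p : ℤ × ℤ, ¬ |p.2| ≤ ⌊f p.1⌋ → Φ p = 0)
    (u : CombVertex f) :
    ∑ w ∈ (Comb f).neighborFinset u, Φ w.1 =
      Φ (u.1.1, u.1.2 + 1) + Φ (u.1.1, u.1.2 - 1) +
        if u.1.2 = 0 then Φ (u.1.1 + 1, 0) + Φ (u.1.1 - 1, 0) else 0 := by
  obtain ⟨⟨x, y⟩, hu⟩ := u
  have hsum : ∑ w ∈ (Comb f).neighborFinset ⟨(x, y), hu⟩, Φ w.1 =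
      ∑ p ∈ (if y = 0 then {(x, y + 1), (x, y - 1), (x + 1, 0), (x - 1, 0)}
        else {(x, y + 1), (x, y - 1)} : Finset (ℤ × ℤ)), Φ p := by
    refine (Finset.sum_map ((Comb f).neighborFinset ⟨(x, y), hu⟩)
      ⟨Subtype.val, Subtype.val_injective⟩ Φ).symm.trans ?_
    refine Finset.sum_subset ?_ ?_
    · intro p hp
      simp only [Finset.mem_map, SimpleGraph.mem_neighborFinset, Function.Embedding.coeFn_mk] at hp
      obtain ⟨⟨⟨a, b⟩, hw⟩, hadj, rfl⟩ := hp
      simp only [Comb] at hadj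
      split_ifs with h <;> simp only [Finset.mem_insert, Finset.mem_singleton, Prod.mk.injEq] <;>
      grind
    · intro p hp hnp
      by_contra hne
      have hm : |p.2| ≤ ⌊f p.1⌋ := by
        by_contra h; exact hne (hΦ p h)
      apply hnp
      simp only [Finset.mem_map, SimpleGraph.mem_neighborFinset, Function.Embedding.coeFn_mk]
      refine ⟨⟨p, (mem_iff p).2 hm⟩, ?_, rfl⟩
      simp only [Comb]
      split_ifs at hp with h <;>
        simp only [Finset.mem_insert, Finset.mem_singleton] at hp
      · rcases hp with rfl | rfl | rfl | rfl <;> simp [h]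
      · rcases hp with rfl | rfl <;> simp
  rw [hsum]
  split_ifs with h
  · rw [Finset.sum_insert, Finset.sum_insert, Finset.sum_insert, Finset.sum_singleton]
    · ring
    · simp only [Finset.mem_singleton, Prod.mk.injEq]; omega
    · simp only [Finset.mem_insert, Finset.mem_singleton, Prod.mk.injEq]; omega
    · simp only [Finset.mem_insert, Finset.mem_singleton, Prod.mk.injEq]; omega
  · rw [Finset.sum_insert, Finset.sum_singleton]
    · ring
    · simp; omega

theorem degree_le (u : CombVertex f) : (Comb f).degree u ≤ 4 := by
  have h := sum_neighborFinset (f := f) (Φ := fun p => if |p.2| ≤ ⌊f p.1⌋ then 1 else 0)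
    (fun p hp => if_neg hp) u
  have h1 : ∑ w ∈ (Comb f).neighborFinset u,
      (if |w.1.2| ≤ ⌊f w.1.1⌋ then (1 : ℝ) else 0) = (Comb f).degree u := by
    rw [Finset.sum_congr rfl fun w _ => if_pos (abs_le_floor w)]
    simp
  rw [h1] at h
  have : ((Comb f).degree u : ℝ) ≤ 4 := by
    rw [h]; dsimp only; split_ifs <;> norm_num
  exact_mod_cast this

theorem one_le_degree (hf : ∀ i, 0 ≤ f i) (u : CombVertex f) : 1 ≤ (Comb f).degree u := by
  rw [Nat.one_le_iff_ne_zero, ← Nat.pos_iff_ne_zero, SimpleGraph.degree_pos_iff_exists_adj]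
  have hu := abs_le_floor u
  obtain ⟨⟨x, y⟩, hm⟩ := u
  dsimp only at hu
  rcases lt_trichotomy y 0 with h | h | h
  · refine ⟨⟨(x, y + 1), (mem_iff _).2 ?_⟩, Or.inl ?_⟩
    · simp only; grind
    · simp
  · refine ⟨⟨(x + 1, 0), (mem_iff _).2 ?_⟩, Or.inr ?_⟩
    · simpa using Int.floor_nonneg.2 (hf (x + 1))
    · simp [h]
  · refine ⟨⟨(x, y - 1), (mem_iff _).2 ?_⟩, Or.inl ?_⟩
    · simp only; grind
    · simp

/-- Twice the potential of the unit flow that starts at `v`, descends to the axis and splits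
evenly between the two directions. -/
def twicePotential (v u : ℤ × ℤ) : ℤ :=
  -- The bracket is the length of the common part of the vertical segments from the axis to `u` and
  -- to `v`. Doubling keeps all values integral.
  (if u.1 = v.1 then 2 * (max 0 (min u.2 v.2) - min 0 (max u.2 v.2)) else 0) - |u.1 - v.1|

theorem twicePotential_le (v u : ℤ × ℤ) : twicePotential v u ≤ 2 * |v.2| := by
  simp only [twicePotential]; grind

theorem twicePotential_self (v : ℤ × ℤ) : twicePotential v v = 2 * |v.2| := by
  simp only [twicePotential, if_true, sub_self, abs_zero, min_self, max_self, sub_zero]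
  rcases abs_cases v.2 with ⟨h, _⟩ | ⟨h, _⟩ <;> omega

theorem neg_le_twicePotential (v u : ℤ × ℤ) : -|u.1 - v.1| ≤ twicePotential v u := by
  simp only [twicePotential]
  split_ifs <;> omega

/-- Kirchhoff's node law: the doubled flow has a source of strength two at `v` and no other source
or sink. -/
theorem twicePotential_flow {F : ℤ → ℤ} {v u : ℤ × ℤ} (hv : |v.2| ≤ F v.1) (hu : |u.2| ≤ F u.1)
    (hF : ∀ i, 0 ≤ F i) :
    (if |u.2 + 1| ≤ F u.1 then twicePotential v u - twicePotential v (u.1, u.2 + 1) else 0) +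
    (if |u.2 - 1| ≤ F u.1 then twicePotential v u - twicePotential v (u.1, u.2 - 1) else 0) +
    (if u.2 = 0 then (twicePotential v u - twicePotential v (u.1 + 1, 0)) +
      (twicePotential v u - twicePotential v (u.1 - 1, 0)) else 0) = if u = v then 2 else 0 := by
  obtain ⟨a, h⟩ := v
  obtain ⟨x, y⟩ := u
  simp only [Prod.mk.injEq] at *
  simp only [twicePotential]
  have hFx := hF x
  by_cases hx : x = a
  · subst hx
    simp only [if_true, sub_self, abs_zero, true_and, show ¬ x + 1 = x by omega,
      show ¬ x - 1 = x by omega, if_false, show x + 1 - x = 1 by ring, show x - 1 - x = -1 by ring,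
      abs_neg, abs_one, abs_le] at *
    by_cases hy : y = 0
    · subst hy
      simp only [if_true]
      split_ifs <;> omega
    · simp only [hy, if_false]
      split_ifs <;> omega
  · simp only [hx, false_and, if_false]
    have h1 : (if x + 1 = a then 2 * (max 0 (min 0 h) - min 0 (max 0 h)) else 0) = 0 := by
      split_ifs <;> omega
    have h2 : (if x - 1 = a then 2 * (max 0 (min 0 h) - min 0 (max 0 h)) else 0) = 0 := by
      split_ifs <;> omega
    rw [h1, h2]
    have h4 : |x + 1 - a| + |x - 1 - a| = 2 * |x - a| := by
      rcases lt_or_gt_of_ne hx with h | h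
      · rw [abs_of_nonpos (by omega), abs_of_nonpos (by omega), abs_of_nonpos (by omega)]; ring
      · rw [abs_of_nonneg (by omega), abs_of_nonneg (by omega), abs_of_nonneg (by omega)]; ring
    split_ifs <;> omega

/-- The potential of the unit flow from `v` to infinity. -/
noncomputable def potential (v u : CombVertex f) : ℝ := twicePotential v.1 u.1 / 2

open scoped Classical in
-- The potential is harmonic off `v`, so after adding a constant it can be compared with Green
-- functions from both sides.
theorem nbrAvg_potential (hf : ∀ i, 0 ≤ f i) (v u : CombVertex f) :
    (Comb f).nbrAvg (potential v) u =
      potential v u - if u = v then 1 / ((Comb f).degree v : ℝ) else 0 := by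
  have hd : ((Comb f).degree u : ℝ) ≠ 0 := by
    have := one_le_degree hf u
    positivity
  have h := sum_neighborFinset (f := f) (Φ := fun p => if |p.2| ≤ ⌊f p.1⌋ then
    (((twicePotential v.1 u.1 - twicePotential v.1 p : ℤ)) : ℝ) else 0)
    (fun p hp => if_neg hp) u
  have h1 : ∑ w ∈ (Comb f).neighborFinset u, (if |w.1.2| ≤ ⌊f w.1.1⌋ then
      (((twicePotential v.1 u.1 - twicePotential v.1 w.1 : ℤ)) : ℝ) else 0) =
      2 * ((Comb f).degree u * potential v u - ∑ w ∈ (Comb f).neighborFinset u, potential v w) := by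
    rw [Finset.sum_congr rfl fun w _ => if_pos (abs_le_floor w)]
    simp only [potential, Int.cast_sub, Finset.sum_sub_distrib, ← Finset.sum_div, Finset.sum_const,
      nsmul_eq_mul, SimpleGraph.card_neighborFinset_eq_degree]
    ring
  have h2 := twicePotential_flow (F := fun i => ⌊f i⌋) (abs_le_floor v) (abs_le_floor u)
    (fun i => Int.floor_nonneg.2 (hf i))
  have h3 := congrArg (Int.cast : ℤ → ℝ) h2
  rw [h1] at h
  simp only [abs_zero, Int.floor_nonneg.2 (hf _), if_true] at h
  push_cast at h h3
  rw [h3] at h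
  have h4 : (u.1 = v.1) ↔ u = v := Subtype.ext_iff.symm
  simp only [h4] at h
  rw [SimpleGraph.nbrAvg]
  by_cases huv : u = v
  · subst huv
    simp only [if_true] at h ⊢
    field_simp
    linarith
  · simp only [huv, if_false] at h ⊢
    field_simp
    linarith

/-- The vertices in the columns `-n, …, n`. -/
noncomputable def box (f : ℤ → ℝ) (n : ℕ) : Finset (CombVertex f) :=
  Set.Finite.toFinset (s := {u : CombVertex f | |u.1.1| ≤ n}) <| by
    have h : (⋃ x ∈ Set.Icc (-(n : ℤ)) n, {x} ×ˢ Set.Icc (-⌊f x⌋) ⌊f x⌋).Finite :=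
      (Set.finite_Icc _ _).biUnion fun x _ => (Set.finite_singleton x).prod (Set.finite_Icc _ _)
    refine (h.preimage Subtype.val_injective.injOn).subset ?_
    intro u hu
    have := abs_le_floor u
    simp only [Set.mem_ofPred_eq, abs_le] at hu this
    simp only [Set.mem_preimage, Set.mem_iUnion, Set.mem_prod, Set.mem_singleton_iff, Set.mem_Icc]
    exact ⟨u.1.1, hu, rfl, this⟩

theorem mem_box {n : ℕ} {u : CombVertex f} : u ∈ box f n ↔ |u.1.1| ≤ n := by
  simp [box]

theorem box_mono {m n : ℕ} (h : m ≤ n) : box f m ⊆ box f n := fun u hu => by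
  rw [mem_box] at *; omega

/-- Boxes consist of whole columns, so a walk leaves only along the axis. Exit points thus have
height zero, however long the teeth. -/
theorem eq_of_adj_of_notMem_box {n : ℕ} {u w : CombVertex f} (hu : u ∈ box f n)
    (hw : w ∉ box f n) (h : (Comb f).Adj u w) : w.1.2 = 0 ∧ |w.1.1| = n + 1 := by
  rw [mem_box] at *
  rcases h with ⟨h1, _⟩ | ⟨_, h2, h3⟩
  · rw [h1] at hu; exact absurd hu hw
  · refine ⟨h2, ?_⟩; grind

/-- The simple random walk on the comb alternates between the two parity classes. -/
theorem killedKernel_odd (B : Finset (CombVertex f)) (t : ℕ) (u z : CombVertex f)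
    (h : Odd (u.1.1 + u.1.2 + z.1.1 + z.1.2 + t)) : (Comb f).killedKernel B t u z = 0 := by
  induction t generalizing u with
  | zero =>
    apply SimpleGraph.killedKernel_zero_ne
    rintro rfl
    grind
  | succ t ih =>
    by_cases hu : u ∈ B
    · rw [SimpleGraph.killedKernel_succ hu, SimpleGraph.nbrAvg, Finset.sum_eq_zero, zero_div]
      intro w hw
      rw [SimpleGraph.mem_neighborFinset] at hw
      refine ih w ?_
      rcases hw with ⟨h1, h2⟩ | ⟨h1, h2, h3⟩
      · grind
      · grind
    · exact SimpleGraph.killedKernel_of_notMem_left hu _ _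

/-- Adding `n + 1` to the potential makes it nonnegative up to one column beyond the box, because
two such columns are at most `2 (n + 1)` apart. -/
theorem sum_killedKernel_box_le (hf : ∀ i, 0 ≤ f i) {n : ℕ} {u z : CombVertex f}
    (hu : u ∈ box f n) (hz : z ∈ box f n) (T : ℕ) :
    (∑ t ∈ Finset.range T, (Comb f).killedKernel (box f n) t u z) / (Comb f).degree z ≤
      n + 1 + |(z.1.2 : ℝ)| := by
  have hd : (0 : ℝ) < (Comb f).degree z := by exact_mod_cast one_le_degree hf z
  have hz' := mem_box.1 hz
  have hnn : ∀ w : CombVertex f, |w.1.1| ≤ n + 1 → 0 ≤ (n + 1 : ℝ) + potential z w := by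
    intro w hw
    have h1 := neg_le_twicePotential z.1 w.1
    have h2 : -(2 * (n + 1 : ℤ)) ≤ twicePotential z.1 w.1 := by grind
    have h3 : ((-(2 * (n + 1 : ℤ)) : ℤ) : ℝ) ≤ twicePotential z.1 w.1 := by exact_mod_cast h2
    push_cast at h3
    rw [potential]; linarith
  have havg : ∀ w, (Comb f).nbrAvg (fun w => ((n + 1 : ℝ) + potential z w) * (Comb f).degree z) w =
      ((n + 1 : ℝ) + (Comb f).nbrAvg (potential z) w) * (Comb f).degree z := by
    intro w
    rw [SimpleGraph.nbrAvg_mul_right, SimpleGraph.nbrAvg_add,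
      SimpleGraph.nbrAvg_const (one_le_degree hf w)]
  have key := SimpleGraph.sum_killedKernel_le (G := Comb f) (B := box f n) (z := z)
    (Ψ := fun w => ((n + 1 : ℝ) + potential z w) * (Comb f).degree z)
    (fun w hw => mul_nonneg (hnn w (by have := mem_box.1 hw; omega)) hd.le)
    (fun w hw x hwx => mul_nonneg (hnn x (by
      by_cases hx : x ∈ box f n
      · have := mem_box.1 hx; omega
      · exact (eq_of_adj_of_notMem_box hw hx hwx).2.le)) hd.le)
    (fun w hw hne => by
      rw [havg, nbrAvg_potential hf, if_neg hne, sub_zero])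
    (by
      rw [havg, nbrAvg_potential hf, if_pos rfl]
      field_simp
      linarith) T hu
  rw [div_le_iff₀ hd]
  refine key.trans (mul_le_mul_of_nonneg_right ?_ hd.le)
  have h4 : (twicePotential z.1 u.1 : ℝ) ≤ ((2 * |z.1.2| : ℤ) : ℝ) := by
    exact_mod_cast twicePotential_le z.1 u.1
  push_cast at h4
  rw [potential]; linarith

theorem eventually_le_sum_killedKernel_box (hf : ∀ i, 0 ≤ f i) {n : ℕ} {v : CombVertex f}
    (hv : v ∈ box f n) :
    ∀ᶠ T in atTop, (n - |(v.1.1 : ℝ)|) / 2 + |(v.1.2 : ℝ)| ≤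
      (∑ t ∈ Finset.range T, (Comb f).killedKernel (box f n) t v v) / (Comb f).degree v := by
  have hd : (0 : ℝ) < (Comb f).degree v := by exact_mod_cast one_le_degree hf v
  -- The constant makes the comparison function nonpositive in the columns `±(n + 1)`. The half lost
  -- in passing from `n + 1` to `n` absorbs the survival term.
  have hlim := SimpleGraph.tendsto_sum_killedKernel_mul (G := Comb f) (B := box f n) (u := v)
    (fun w => ((n + 1 - |(v.1.1 : ℝ)|) / 2 + potential v w) * (Comb f).degree v)
    (fun y hy => ⟨(n + 1 + |(y.1.2 : ℝ)|) * (Comb f).degree y, fun T => by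
      rw [← div_le_iff₀ (by exact_mod_cast one_le_degree hf y)]
      exact sum_killedKernel_box_le hf hv hy T⟩)
  have hev := hlim.eventually (gt_mem_nhds (show (0 : ℝ) < (Comb f).degree v / 2 by positivity))
  filter_upwards [hev] with T hT
  have havg : ∀ w, (Comb f).nbrAvg
      (fun w => ((n + 1 - |(v.1.1 : ℝ)|) / 2 + potential v w) * (Comb f).degree v) w =
      ((n + 1 - |(v.1.1 : ℝ)|) / 2 + (Comb f).nbrAvg (potential v) w) * (Comb f).degree v := by
    intro w
    rw [SimpleGraph.nbrAvg_mul_right, SimpleGraph.nbrAvg_add,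
      SimpleGraph.nbrAvg_const (one_le_degree hf w)]
  have key := SimpleGraph.le_sum_killedKernel_add (G := Comb f) (B := box f n) (z := v)
    (Ψ := fun w => ((n + 1 - |(v.1.1 : ℝ)|) / 2 + potential v w) * (Comb f).degree v)
    (fun w hw x hx hwx => by
      refine mul_nonpos_of_nonpos_of_nonneg ?_ hd.le
      obtain ⟨_, h2⟩ := eq_of_adj_of_notMem_box hw hx hwx
      have hv' := mem_box.1 hv
      have h3 : twicePotential v.1 x.1 ≤ -(n + 1 - |v.1.1|) := by
        rw [twicePotential, if_neg (by grind)]; grind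
      have h4 : (twicePotential v.1 x.1 : ℝ) ≤ ((-(n + 1 - |v.1.1|) : ℤ) : ℝ) := by
        exact_mod_cast h3
      push_cast at h4
      rw [potential]; linarith)
    (fun w hw hne => by
      rw [havg, nbrAvg_potential hf, if_neg hne, sub_zero])
    (by
      rw [havg, nbrAvg_potential hf, if_pos rfl]
      field_simp
      linarith) T hv
  rw [le_div_iff₀ hd]
  have h5 : potential v v = |(v.1.2 : ℝ)| := by
    rw [potential, twicePotential_self]; push_cast; ring
  rw [h5] at key
  nlinarith

theorem sum_sum_killedKernel_sq_le (hf : ∀ i, 0 ≤ f i) {n : ℕ} {u : CombVertex f}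
    (hu : u ∈ box f n) (T : ℕ) :
    ∑ t ∈ Finset.range T, ∑ z ∈ box f n, (Comb f).killedKernel (box f n) t u z ^ 2 ≤
      4 * (n + 1 + |(u.1.2 : ℝ)|) :=
  (SimpleGraph.sum_sum_sq_le (D := 4) (fun z => by exact_mod_cast degree_le z)
    (one_le_degree hf u) T).trans
    (mul_le_mul_of_nonneg_left (sum_killedKernel_box_le hf hu hu _) (by norm_num))

/-- The ratio 64 makes half of the energy in the large box, about `16 n`, outweigh the energy in the
small one, at most `4 (n + 1 + |v.1.2|)`. -/
theorem eventually_le_shellEnergy (hf : ∀ i, 0 ≤ f i) {n : ℕ} {v : CombVertex f}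
    (hn : |v.1.1| + |v.1.2| + 1 ≤ n) :
    ∀ᶠ T in atTop,
      (n : ℝ) ≤ (Comb f).shellEnergy (box f n) (box f (64 * n)) (box f (64 * n)) T v := by
  have hv : v ∈ box f n := mem_box.2 (by have := abs_nonneg v.1.2; omega)
  have hv' : v ∈ box f (64 * n) := box_mono (by omega) hv
  have h2 : Tendsto (fun T : ℕ => 2 * T) atTop atTop :=
    tendsto_id.const_mul_atTop' (by norm_num)
  filter_upwards [h2.eventually (eventually_le_sum_killedKernel_box hf hv')] with T hT
  have h3 := SimpleGraph.le_sum_sum_sq (G := Comb f) (B := box f (64 * n)) (one_le_degree hf)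
    (u := v) (fun t => killedKernel_odd _ _ _ _ ⟨v.1.1 + v.1.2 + t, by push_cast; ring⟩) T
  have h4 := sum_sum_killedKernel_sq_le hf hv T
  have h5 := SimpleGraph.le_shellEnergy (G := Comb f) (box_mono (f := f)
    (show n ≤ 64 * n by omega)) T v
  have hn' : |(v.1.1 : ℝ)| + |(v.1.2 : ℝ)| + 1 ≤ n := by exact_mod_cast hn
  push_cast at hT
  have := abs_nonneg (v.1.1 : ℝ)
  have := abs_nonneg (v.1.2 : ℝ)
  linarith

end Comb

end CombGeometry

/-! ### Distribution of the energy along a tooth, and dependence of the energy on the starting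
vertex. -/

section ToothMonotonicity

theorem sum_range_le_sum_range_succ {g : ℕ → ℝ} (h0 : g 0 = 0) (hg : ∀ t, 0 ≤ g t) (T : ℕ) :
    ∑ t ∈ Finset.range T, g t ≤ ∑ t ∈ Finset.range T, g (t + 1) := by
  have h1 := Finset.sum_range_succ g T
  have h2 := Finset.sum_range_succ' g T
  linarith [hg T]

theorem sum_range_succ_add_neg (E : ℤ → ℝ) (m : ℕ) :
    ∑ h ∈ Finset.range (m + 1), (E h + E (-h)) = ∑ y ∈ Finset.Icc (-(m : ℤ)) m, E y + E 0 := by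
  induction m with
  | zero => simp
  | succ m ih =>
    rw [Finset.sum_range_succ, ih]
    have : Finset.Icc (-((m + 1 : ℕ) : ℤ)) (m + 1 : ℕ) =
        insert ((m + 1 : ℕ) : ℤ) (insert (-((m + 1 : ℕ) : ℤ)) (Finset.Icc (-(m : ℤ)) m)) := by
      ext y; simp only [Finset.mem_Icc, Finset.mem_insert]; omega
    rw [this, Finset.sum_insert, Finset.sum_insert]
    · ring
    · simp only [Finset.mem_Icc]; omega
    · simp only [Finset.mem_Icc, Finset.mem_insert]; omega

/-- The initial averages of a decreasing sequence decrease. -/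
theorem mul_sum_range_le_of_antitone {e : ℕ → ℝ} {F m : ℕ} (hm : m ≤ F)
    (he : ∀ h < F, e (h + 1) ≤ e h) :
    (m + 1 : ℝ) * ∑ h ∈ Finset.range (F + 1), e h ≤
      (F + 1 : ℝ) * ∑ h ∈ Finset.range (m + 1), e h := by
  induction F, hm using Nat.le_induction with
  | base => exact le_rfl
  | succ F hmF ih =>
    have h1 := ih fun h hh => he h (by omega)
    have anti : ∀ i ≤ F + 1, e (F + 1) ≤ e i := by
      intro i hi
      induction hi using Nat.decreasingInduction with
      | self => exact le_rfl
      | of_succ k hk ih => exact (ih).trans (he k hk)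
    have h2 : (m + 1 : ℝ) * e (F + 1) ≤ ∑ h ∈ Finset.range (m + 1), e h := by
      have := Finset.card_nsmul_le_sum (Finset.range (m + 1)) e (e (F + 1)) fun i hi => by
        rw [Finset.mem_range] at hi; exact anti i (by omega)
      simpa using this
    rw [Finset.sum_range_succ]
    push_cast
    linarith

/-- A convex sequence with a nonpositive final increment is decreasing. -/
theorem antitone_of_convex {e : ℕ → ℝ} {F : ℕ}
    (hc : ∀ h, h + 1 < F → 2 * e (h + 1) ≤ e (h + 2) + e h)
    (htop : ∀ h, h + 1 = F → e (h + 1) ≤ e h) : ∀ h < F, e (h + 1) ≤ e h := by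
  intro h hh
  have hh' : h + 1 ≤ F := hh
  clear hh
  obtain ⟨k, rfl⟩ := Nat.exists_eq_add_of_le hh'
  induction k generalizing h with
  | zero => exact htop h rfl
  | succ k ih =>
    have h1 := ih (h + 1) (fun j hj => hc j (by omega)) (fun j hj => htop j (by omega)) (by omega)
    have h2 := hc h (by omega)
    have : e (h + 1 + 1) = e (h + 2) := rfl
    linarith

/-- If `E` is convex along both halves of a tooth and does not increase at the two tips, then the
part of the tooth up to height `m` carries its share of the total. -/
theorem tooth_sum_le {E : ℤ → ℝ} {F m : ℕ} (hm : m ≤ F) (hE : 0 ≤ E 0)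
    (hE' : ∀ y, 0 ≤ E y)
    (hc : ∀ y : ℤ, y ≠ 0 → |y| < F → 2 * E y ≤ E (y + 1) + E (y - 1))
    (h1 : 1 ≤ F → E F ≤ E (F - 1)) (h2 : 1 ≤ F → E (-F) ≤ E (-F + 1)) :
    (m + 1 : ℝ) * ∑ y ∈ Finset.Icc (-(F : ℤ)) F, E y ≤
      2 * (F + 1 : ℝ) * ∑ y ∈ Finset.Icc (-(m : ℤ)) m, E y := by
  -- Folding the tooth treats both halves at once. The axis is then counted twice, whence the factor
  -- `2` in the conclusion.
  have anti : ∀ h < F, (fun h : ℕ => E h + E (-h)) (h + 1) ≤ (fun h : ℕ => E h + E (-h)) h := by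
    refine antitone_of_convex (e := fun h : ℕ => E h + E (-h)) ?_ ?_
    · intro h hh
      have c1 := hc (h + 1) (by omega) (by rw [abs_of_nonneg] <;> omega)
      have c2 := hc (-(h + 1)) (by omega) (by rw [abs_neg, abs_of_nonneg] <;> omega)
      rw [show (h + 1 + 1 : ℤ) = h + 2 by ring, show (h + 1 - 1 : ℤ) = h by ring] at c1
      rw [show (-(h + 1) + 1 : ℤ) = -h by ring, show (-(h + 1) - 1 : ℤ) = -(h + 2) by ring] at c2
      push_cast
      linarith
    · intro h hh
      subst hh
      have c1 := h1 (by omega)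
      have c2 := h2 (by omega)
      push_cast at c1 c2 ⊢
      rw [show (h + 1 - 1 : ℤ) = h by ring] at c1
      rw [show (-(h + 1) + 1 : ℤ) = -h by ring] at c2
      linarith
  have key := mul_sum_range_le_of_antitone (e := fun h : ℕ => E h + E (-h)) hm anti
  rw [sum_range_succ_add_neg, sum_range_succ_add_neg] at key
  have h3 : E 0 ≤ ∑ y ∈ Finset.Icc (-(m : ℤ)) m, E y :=
    Finset.single_le_sum (f := E) (fun y _ => hE' y) (by simp)
  have h4 : (m + 1 : ℝ) * ∑ y ∈ Finset.Icc (-(F : ℤ)) F, E y ≤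
      (m + 1 : ℝ) * (∑ y ∈ Finset.Icc (-(F : ℤ)) F, E y + E 0) :=
    mul_le_mul_of_nonneg_left (by linarith) (by positivity)
  have h5 : (F + 1 : ℝ) * (∑ y ∈ Finset.Icc (-(m : ℤ)) m, E y + E 0) ≤
      (F + 1 : ℝ) * (2 * ∑ y ∈ Finset.Icc (-(m : ℤ)) m, E y) :=
    mul_le_mul_of_nonneg_left (by linarith) (by positivity)
  linarith

namespace Comb

variable {f : ℤ → ℝ}

/-- Extension by zero of a function on the vertices of the comb. -/
noncomputable def extend (F : CombVertex f → ℝ) (p : ℤ × ℤ) : ℝ :=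
  if h : |p.2| ≤ ⌊f p.1⌋ then F ⟨p, (mem_iff p).2 h⟩ else 0

theorem extend_val (F : CombVertex f → ℝ) (u : CombVertex f) : extend F u.1 = F u :=
  dif_pos (abs_le_floor u)

theorem extend_of_not {F : CombVertex f → ℝ} {p : ℤ × ℤ} (h : ¬ |p.2| ≤ ⌊f p.1⌋) :
    extend F p = 0 := dif_neg h

theorem sum_neighborFinset_tooth (F : CombVertex f → ℝ) {u : CombVertex f} (hu : u.1.2 ≠ 0) :
    ∑ w ∈ (Comb f).neighborFinset u, F w =
      extend F (u.1.1, u.1.2 + 1) + extend F (u.1.1, u.1.2 - 1) := by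
  rw [← Finset.sum_congr rfl fun w _ => extend_val F w,
    sum_neighborFinset (fun p hp => extend_of_not hp), if_neg hu, add_zero]

/-- The vertices of `box f n` at height at most `n`. -/
noncomputable def lowBox (f : ℤ → ℝ) (n : ℕ) : Finset (CombVertex f) :=
  (box f n).filter fun z => |z.1.2| ≤ n

theorem mem_lowBox {n : ℕ} {u : CombVertex f} : u ∈ lowBox f n ↔ |u.1.1| ≤ n ∧ |u.1.2| ≤ n := by
  rw [lowBox, Finset.mem_filter, mem_box]

theorem lowBox_subset (n : ℕ) : lowBox f n ⊆ box f n := Finset.filter_subset _ _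

theorem sum_box (F : CombVertex f → ℝ) (n : ℕ) :
    ∑ z ∈ box f n, F z = ∑ x ∈ Finset.Icc (-(n : ℤ)) n,
      ∑ y ∈ Finset.Icc (-⌊f x⌋) ⌊f x⌋, extend F (x, y) := by
  rw [Finset.sum_sigma']
  refine Finset.sum_bij (fun z _ => ⟨z.1.1, z.1.2⟩) ?_ ?_ ?_ ?_
  · intro z hz
    have := abs_le_floor z
    rw [mem_box] at hz
    simp only [Finset.mem_sigma, Finset.mem_Icc]
    exact ⟨abs_le.1 hz, abs_le.1 this⟩
  · rintro ⟨⟨a, b⟩, h⟩ _ ⟨⟨c, d⟩, h'⟩ _ he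
    simpa using he
  · rintro ⟨x, y⟩ h
    simp only [Finset.mem_sigma, Finset.mem_Icc] at h
    exact ⟨⟨(x, y), (mem_iff _).2 (abs_le.2 h.2)⟩, mem_box.2 (abs_le.2 h.1), rfl⟩
  · intro z _
    exact (extend_val F z).symm

theorem sum_lowBox (F : CombVertex f → ℝ) (n : ℕ) :
    ∑ z ∈ lowBox f n, F z = ∑ x ∈ Finset.Icc (-(n : ℤ)) n,
      ∑ y ∈ Finset.Icc (-min (n : ℤ) ⌊f x⌋) (min (n : ℤ) ⌊f x⌋), extend F (x, y) := by
  rw [lowBox, Finset.sum_filter, sum_box]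
  refine Finset.sum_congr rfl fun x _ => ?_
  symm
  have hsub : Finset.Icc (-min (n : ℤ) ⌊f x⌋) (min (n : ℤ) ⌊f x⌋) ⊆
      Finset.Icc (-⌊f x⌋) ⌊f x⌋ := by
    intro y; simp only [Finset.mem_Icc]; omega
  rw [← Finset.sum_subset hsub]
  · refine Finset.sum_congr rfl fun y hy => ?_
    simp only [Finset.mem_Icc] at hy
    rw [extend, extend, dif_pos (abs_le.2 ⟨by simp only; omega, by simp only; omega⟩),
      dif_pos (abs_le.2 ⟨by simp only; omega, by simp only; omega⟩), if_pos]
    exact abs_le.2 ⟨by simp only; omega, by simp only; omega⟩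
  · intro y hy hy'
    rw [extend]
    split_ifs with h h'
    · exfalso
      simp only [Finset.mem_Icc, abs_le] at hy hy' h'
      omega
    · rfl
    · rfl

theorem degree_tooth {u : CombVertex f} (hu : u.1.2 ≠ 0) :
    ((Comb f).degree u : ℝ) = (if |u.1.2 + 1| ≤ ⌊f u.1.1⌋ then 1 else 0) +
      (if |u.1.2 - 1| ≤ ⌊f u.1.1⌋ then 1 else 0) := by
  have h := sum_neighborFinset_tooth (fun _ => (1 : ℝ)) hu
  simpa [extend] using h

section

variable (B C : Finset (CombVertex f)) (T : ℕ) (v : CombVertex f)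

/-- The contribution of a vertex to the shell energy, in terms of densities with respect to the
degree. -/
noncomputable def siteEnergy (z : CombVertex f) : ℝ :=
  ∑ t ∈ Finset.range T, ((Comb f).shellKernel B C t v z / (Comb f).degree z) ^ 2

theorem siteEnergy_nonneg (z : CombVertex f) : 0 ≤ siteEnergy B C T v z :=
  Finset.sum_nonneg fun _ _ => sq_nonneg _

theorem extend_siteEnergy_nonneg (p : ℤ × ℤ) : 0 ≤ extend (siteEnergy B C T v) p := by
  rw [extend]; split_ifs
  · exact siteEnergy_nonneg _ _ _ _ _
  · exact le_rfl

theorem extend_siteEnergy (p : ℤ × ℤ) : extend (siteEnergy B C T v) p =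
    ∑ t ∈ Finset.range T, (extend (fun z => (Comb f).shellKernel B C t v z / (Comb f).degree z) p) ^ 2 := by
  simp only [extend]
  split_ifs
  · rfl
  · simp

end

section

variable {m n : ℕ} {v : CombVertex f} (T : ℕ)

/-- Densities obey the averaging recursion. The term at time `0` vanishes since `v` starts in the
inner box, so the time sum may be shifted; off the axis, neighbours share a column, so the forward
recursion of the shell kernel applies. -/
theorem siteEnergy_le (hmn : m ≤ n) (hv : v ∈ box f m) {z : CombVertex f} (hz : z ∈ box f n)
    (hz0 : z.1.2 ≠ 0) :
    siteEnergy (box f m) (box f n) T v z ≤ ∑ t ∈ Finset.range T,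
      ((extend (fun z => (Comb f).shellKernel (box f m) (box f n) t v z / (Comb f).degree z)
          (z.1.1, z.1.2 + 1) +
        extend (fun z => (Comb f).shellKernel (box f m) (box f n) t v z / (Comb f).degree z)
          (z.1.1, z.1.2 - 1)) / (Comb f).degree z) ^ 2 := by
  refine (sum_range_le_sum_range_succ ?_ (fun _ => sq_nonneg _) T).trans (le_of_eq ?_)
  · rw [SimpleGraph.shellKernel_zero (box_mono hmn) hv]; simp
  · refine Finset.sum_congr rfl fun t _ => ?_
    rw [SimpleGraph.shellKernel_succ' hz, sum_neighborFinset_tooth _ hz0]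
    intro hzm w hzw hw
    rcases hzw with ⟨h1, _⟩ | ⟨h1, _⟩
    · exact hzm (mem_box.2 (h1 ▸ mem_box.1 hw))
    · exact hz0 h1

/-- Inside a tooth the degree is two, and the square of a mean is at most the mean of the squares.
-/
theorem siteEnergy_convex (hmn : m ≤ n) (hv : v ∈ box f m) {x y : ℤ} (hx : |x| ≤ n) (hy0 : y ≠ 0)
    (hy : |y| < ⌊f x⌋) :
    2 * extend (siteEnergy (box f m) (box f n) T v) (x, y) ≤
      extend (siteEnergy (box f m) (box f n) T v) (x, y + 1) +
      extend (siteEnergy (box f m) (box f n) T v) (x, y - 1) := by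
  have h := siteEnergy_le T hmn hv (z := ⟨(x, y), (mem_iff _).2 hy.le⟩) (mem_box.2 hx) hy0
  have hd : ((Comb f).degree (⟨(x, y), (mem_iff _).2 hy.le⟩ : CombVertex f) : ℝ) = 2 := by
    rw [degree_tooth hy0, if_pos, if_pos]
    · norm_num
    · simp only; grind
    · simp only; grind
  rw [← extend_val (siteEnergy (box f m) (box f n) T v), hd] at h
  rw [extend_siteEnergy _ _ _ _ (x, y + 1), extend_siteEnergy _ _ _ _ (x, y - 1),
    ← Finset.sum_add_distrib]
  have h2 := mul_le_mul_of_nonneg_left h (zero_le_two (α := ℝ))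
  refine h2.trans ?_
  rw [Finset.mul_sum]
  refine Finset.sum_le_sum fun t _ => ?_
  generalize extend _ (x, y + 1) = p
  generalize extend _ (x, y - 1) = q
  nlinarith [sq_nonneg (p - q)]

/-- A tip has one neighbour, so its density is that of the neighbour one step earlier. -/
theorem siteEnergy_top (hmn : m ≤ n) (hv : v ∈ box f m) {x : ℤ} (hx : |x| ≤ n)
    (hF : 1 ≤ ⌊f x⌋) :
    extend (siteEnergy (box f m) (box f n) T v) (x, ⌊f x⌋) ≤
      extend (siteEnergy (box f m) (box f n) T v) (x, ⌊f x⌋ - 1) := by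
  have hy : |⌊f x⌋| ≤ ⌊f x⌋ := abs_of_nonneg (by omega) |>.le
  have hy0 : ⌊f x⌋ ≠ 0 := by omega
  have h := siteEnergy_le T hmn hv (z := ⟨(x, ⌊f x⌋), (mem_iff _).2 hy⟩) (mem_box.2 hx) hy0
  have hn : ¬ |⌊f x⌋ + 1| ≤ ⌊f x⌋ := by grind
  have hd : ((Comb f).degree (⟨(x, ⌊f x⌋), (mem_iff _).2 hy⟩ : CombVertex f) : ℝ) = 1 := by
    rw [degree_tooth hy0, if_neg hn, if_pos]
    · norm_num
    · simp only; grind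
  rw [← extend_val (siteEnergy (box f m) (box f n) T v), hd] at h
  rw [extend_siteEnergy _ _ _ _ (x, ⌊f x⌋ - 1)]
  refine h.trans (le_of_eq (Finset.sum_congr rfl fun t _ => ?_))
  rw [extend_of_not (p := (x, ⌊f x⌋ + 1)) hn, zero_add, div_one]

theorem siteEnergy_bot (hmn : m ≤ n) (hv : v ∈ box f m) {x : ℤ} (hx : |x| ≤ n)
    (hF : 1 ≤ ⌊f x⌋) :
    extend (siteEnergy (box f m) (box f n) T v) (x, -⌊f x⌋) ≤
      extend (siteEnergy (box f m) (box f n) T v) (x, -⌊f x⌋ + 1) := by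
  have hy : |-⌊f x⌋| ≤ ⌊f x⌋ := (abs_neg _).trans_le (abs_of_nonneg (by omega) |>.le)
  have hy0 : -⌊f x⌋ ≠ 0 := by omega
  have h := siteEnergy_le T hmn hv (z := ⟨(x, -⌊f x⌋), (mem_iff _).2 hy⟩) (mem_box.2 hx) hy0
  have hn : ¬ |-⌊f x⌋ - 1| ≤ ⌊f x⌋ := by grind
  have hd : ((Comb f).degree (⟨(x, -⌊f x⌋), (mem_iff _).2 hy⟩ : CombVertex f) : ℝ) = 1 := by
    rw [degree_tooth hy0, if_neg hn, if_pos]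
    · norm_num
    · simp only; grind
  rw [← extend_val (siteEnergy (box f m) (box f n) T v), hd] at h
  rw [extend_siteEnergy _ _ _ _ (x, -⌊f x⌋ + 1)]
  refine h.trans (le_of_eq (Finset.sum_congr rfl fun t _ => ?_))
  rw [extend_of_not (p := (x, -⌊f x⌋ - 1)) hn, add_zero, div_one]

theorem floor_le_runningMax {x : ℤ} (hx : x ∈ Finset.Icc (-(n : ℤ)) n) :
    (⌊f x⌋ : ℝ) ≤ runningMax f n :=
  (Int.floor_le _).trans ((Finset.le_sup' f hx).trans (le_max_right _ _))

theorem one_le_runningMax (f : ℤ → ℝ) (n : ℕ) : 1 ≤ runningMax f n := le_max_left _ _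

/-- The low part of the box carries a fixed share of the collisions. -/
theorem shellEnergy_le_lowBox (hf : ∀ i, 0 ≤ f i) (hmn : m ≤ n) (hv : v ∈ box f m) :
    min 1 (n / runningMax f n) *
        (Comb f).shellEnergy (box f m) (box f n) (box f n) T v ≤
      64 * (Comb f).shellEnergy (box f m) (box f n) (lowBox f n) T v := by
  set E := siteEnergy (box f m) (box f n) T v with hE
  have hR := one_le_runningMax f n
  set r := min 1 (n / runningMax f n) with hr
  have hr0 : 0 ≤ r := le_min zero_le_one (by positivity)
  have hcol : ∀ x ∈ Finset.Icc (-(n : ℤ)) n,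
      r * ∑ y ∈ Finset.Icc (-⌊f x⌋) ⌊f x⌋, extend E (x, y) ≤
      4 * ∑ y ∈ Finset.Icc (-min (n : ℤ) ⌊f x⌋) (min (n : ℤ) ⌊f x⌋), extend E (x, y) := by
    intro x hx
    have hxn : |x| ≤ n := abs_le.2 (Finset.mem_Icc.1 hx)
    have hfl := floor_le_runningMax (f := f) hx
    obtain ⟨F, hF⟩ := Int.eq_ofNat_of_zero_le (Int.floor_nonneg.2 (hf x))
    have hmin : min (n : ℤ) ⌊f x⌋ = (min n F : ℕ) := by rw [hF]; simp
    have key := tooth_sum_le (E := fun y => extend E (x, y)) (F := F) (m := min n F)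
      (min_le_right _ _) (extend_siteEnergy_nonneg _ _ _ _ _)
      (fun y => extend_siteEnergy_nonneg _ _ _ _ _)
      (fun y hy0 hy => siteEnergy_convex T hmn hv hxn hy0 (by rw [hF]; exact hy))
      (fun h1 => by
        have := siteEnergy_top T hmn hv hxn (by omega)
        rwa [hF] at this)
      (fun h1 => by
        have := siteEnergy_bot T hmn hv hxn (by omega)
        rwa [hF] at this)
    rw [hmin, hF]
    rw [hF] at hfl
    push_cast at hfl
    -- A tooth with `F ≤ n` lies entirely in the low box; otherwise `F ≤ runningMax f n` bounds the
    -- loss.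
    have hratio : r * (F + 1) ≤ 2 * ((min n F : ℕ) + 1) := by
      rcases le_total F n with h | h
      · rw [min_eq_right h]
        have : r ≤ 1 := min_le_left _ _
        have hF0 : (0 : ℝ) ≤ F := Nat.cast_nonneg F
        nlinarith
      · rw [min_eq_left h]
        have h1 : r ≤ n / runningMax f n := min_le_right _ _
        have h2 : r * runningMax f n ≤ n := by rwa [le_div_iff₀ (by linarith)] at h1
        nlinarith
    have hS : 0 ≤ ∑ y ∈ Finset.Icc (-(F : ℤ)) F, extend E (x, y) :=
      Finset.sum_nonneg fun y _ => extend_siteEnergy_nonneg _ _ _ _ _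
    have hFp : (0 : ℝ) < F + 1 := by positivity
    have h3 := mul_le_mul_of_nonneg_right hratio hS
    rw [← mul_le_mul_iff_of_pos_left hFp]
    linarith
  have hall : r * ∑ z ∈ box f n, E z ≤ 4 * ∑ z ∈ lowBox f n, E z := by
    rw [sum_box, sum_lowBox, Finset.mul_sum, Finset.mul_sum]
    exact Finset.sum_le_sum hcol
  have hdeg : ∀ z : CombVertex f, (1 : ℝ) ≤ (Comb f).degree z := fun z => by
    exact_mod_cast one_le_degree hf z
  have hdeg4 : ∀ z : CombVertex f, ((Comb f).degree z : ℝ) ≤ 4 := fun z => by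
    exact_mod_cast degree_le z
  -- Passing from densities to probabilities costs the squared maximal degree `4 ^ 2`; with the
  -- factor `4` of `hall` this gives `64`.
  have hup : (Comb f).shellEnergy (box f m) (box f n) (box f n) T v ≤ 16 * ∑ z ∈ box f n, E z := by
    rw [SimpleGraph.shellEnergy, Finset.sum_comm, Finset.mul_sum]
    refine Finset.sum_le_sum fun z _ => ?_
    rw [hE, siteEnergy, Finset.mul_sum]
    refine Finset.sum_le_sum fun t _ => ?_
    have h1 := hdeg z
    rw [div_pow, ← mul_div_assoc, le_div_iff₀ (by positivity), mul_comm]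
    refine mul_le_mul_of_nonneg_right ?_ (sq_nonneg _)
    nlinarith [hdeg4 z]
  have hlow : ∑ z ∈ lowBox f n, E z ≤
      (Comb f).shellEnergy (box f m) (box f n) (lowBox f n) T v := by
    rw [SimpleGraph.shellEnergy, Finset.sum_comm]
    refine Finset.sum_le_sum fun z _ => ?_
    rw [hE, siteEnergy]
    refine Finset.sum_le_sum fun t _ => ?_
    have h1 := hdeg z
    rw [div_pow]
    exact div_le_self (sq_nonneg _) (by nlinarith)
  nlinarith [mul_le_mul_of_nonneg_left hup hr0]

end

/-- The key comparison: collisions of walks from a vertex near the origin, against collisions of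
walks from the base vertex. -/
theorem sqrt_shellEnergy_lowBox_le (hf : ∀ i, 0 ≤ f i) {v : CombVertex f} {j n : ℕ}
    (hj : 2 * (|v.1.1| + |v.1.2|) + 1 ≤ j) (hjn : j ≤ n) (T : ℕ) {u : CombVertex f}
    (hu : u ∈ lowBox f j) :
    √((Comb f).shellEnergy (box f n) (box f (64 * n)) (lowBox f (64 * n)) T u) ≤
      √((Comb f).shellEnergy (box f n) (box f (64 * n)) (lowBox f (64 * n)) T v) +
        72 * √n * (j / n) := by
  rw [mem_lowBox] at hu
  have hn1 : (1 : ℝ) ≤ n := by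
    have := abs_nonneg v.1.1
    have := abs_nonneg v.1.2
    exact_mod_cast (by omega : 1 ≤ n)
  -- At exit points the root of the energy is at most `18 √n` and `|v.1.2| - potential v` is at
  -- least `n / 4`; `K` makes their comparison exact.
  set K : ℝ := 72 * √n / n with hK
  have hK0 : 0 ≤ K := by positivity
  have hpot : ∀ w : CombVertex f, 0 ≤ |(v.1.2 : ℝ)| - potential v w := by
    intro w
    have h1 : (twicePotential v.1 w.1 : ℝ) ≤ ((2 * |v.1.2| : ℤ) : ℝ) := by
      exact_mod_cast twicePotential_le v.1 w.1
    push_cast at h1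
    rw [potential]; linarith
  have key := SimpleGraph.sqrt_shellEnergy_le (G := Comb f) (box_mono (f := f)
    (show n ≤ 64 * n by omega)) (lowBox f (64 * n)) (v := v)
    (φ := fun w => (|(v.1.2 : ℝ)| - potential v w) * K) (T := T)
    (fun w _ => mul_nonneg (hpot w) hK0) (fun w _ => one_le_degree hf w)
    (fun w _ hwv => by
      rw [SimpleGraph.nbrAvg_mul_right, SimpleGraph.nbrAvg_sub,
        SimpleGraph.nbrAvg_const (one_le_degree hf w), nbrAvg_potential hf, if_neg hwv, sub_zero])
    (fun w hw x hx hwx => by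
      obtain ⟨h1, h2⟩ := eq_of_adj_of_notMem_box hw hx hwx
      have hn64 : |x.1.1| ≤ (64 * n : ℕ) := by
        have : 1 ≤ n := by exact_mod_cast hn1
        rw [h2]; push_cast; omega
      have h3 := (SimpleGraph.shellEnergy_le (box_mono (f := f) (show n ≤ 64 * n by omega))
        (lowBox_subset (64 * n)) T x).trans (sum_sum_killedKernel_sq_le hf (mem_box.2 hn64) T)
      rw [h1] at h3
      push_cast at h3
      -- Exit points have height zero, so the energy is at most `4 (64 n + 1) ≤ 260 n`, rounded up
      -- to a square multiple of `n`.
      have h4 : (Comb f).shellEnergy (box f n) (box f (64 * n)) (lowBox f (64 * n)) T x ≤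
          18 ^ 2 * n := by
        simp only [abs_zero, add_zero] at h3; linarith
      have h5 := Real.sqrt_le_sqrt h4
      rw [Real.sqrt_mul (by norm_num), Real.sqrt_sq (by norm_num)] at h5
      refine h5.trans ?_
      have h6 : 2 * twicePotential v.1 x.1 ≤ -n := by
        rw [twicePotential, if_neg (by grind)]; grind
      have h7 : 2 * (twicePotential v.1 x.1 : ℝ) ≤ -n := by exact_mod_cast h6
      have h8 : (n : ℝ) / 4 ≤ |(v.1.2 : ℝ)| - potential v x := by
        have := abs_nonneg (v.1.2 : ℝ)
        rw [potential]; linarith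
      refine le_trans (le_of_eq ?_) (mul_le_mul_of_nonneg_right h8 hK0)
      rw [hK]
      field_simp
      norm_num)
    (u := u) (mem_box.2 (by omega))
  refine key.trans (add_le_add_right ?_ _)
  have h1 := neg_le_twicePotential v.1 u.1
  have h2 : -(2 * (j : ℤ)) ≤ twicePotential v.1 u.1 - 2 * |v.1.2| := by
    grind
  have h3 : -(2 * (j : ℝ)) ≤ twicePotential v.1 u.1 - 2 * |(v.1.2 : ℝ)| := by
    exact_mod_cast h2
  have h4 : |(v.1.2 : ℝ)| - potential v u ≤ j := by
    rw [potential]; linarith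
  refine (mul_le_mul_of_nonneg_right h4 hK0).trans (le_of_eq ?_)
  rw [hK]; ring

end Comb

end ToothMonotonicity

/-! ### Path events of the walk and their probabilities in terms of killed kernels. -/

section PathSpace

variable {V : Type*} {B C B' C' : Finset V}

/-- The event that a path is determined by its first `n + 1` positions. -/
def DeterminedBy (n : ℕ) (A : Set (ℕ → V)) : Prop :=
  ∀ x y : ℕ → V, (∀ i ≤ n, x i = y i) → x ∈ A → y ∈ A

/-- The paths that are in `B` during the times `s, …, s + t` and at `z` at time `s + t`. -/
def stayEvent (B : Finset V) (s t : ℕ) (z : V) : Set (ℕ → V) :=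
  {x | x (s + t) = z ∧ ∀ i, s ≤ i → i ≤ s + t → x i ∈ B}

theorem determinedBy_stayEvent (B : Finset V) (s t : ℕ) (z : V) :
    DeterminedBy (s + t) (stayEvent B s t z) := by
  rintro x y h ⟨h1, h2⟩
  exact ⟨by rw [← h _ le_rfl, h1], fun i hi hi' => by rw [← h i hi']; exact h2 i hi hi'⟩

theorem DeterminedBy.inter {n m : ℕ} {A A' : Set (ℕ → V)} (h : DeterminedBy n A)
    (h' : DeterminedBy m A') (hnm : n ≤ m) : DeterminedBy m (A ∩ A') :=
  fun x y hxy hx => ⟨h x y (fun i hi => hxy i (hi.trans hnm)) hx.1, h' x y hxy hx.2⟩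

/-- The paths that are at `z` at time `t`, have stayed in `C` and have left `B`. -/
def shellEvent (B C : Finset V) (t : ℕ) (z : V) : Set (ℕ → V) :=
  stayEvent C 0 t z \ stayEvent B 0 t z

theorem determinedBy_shellEvent (t : ℕ) (z : V) : DeterminedBy t (shellEvent B C t z) := by
  intro x y h hx
  have h1 := determinedBy_stayEvent C 0 t z
  have h2 := determinedBy_stayEvent B 0 t z
  rw [zero_add] at h1 h2
  exact ⟨h1 x y h hx.1, fun hy => hx.2 (h2 y x (fun i hi => (h i hi).symm) hy)⟩

theorem apply_of_mem_shellEvent {t : ℕ} {z : V} {x : ℕ → V} (h : x ∈ shellEvent B C t z) :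
    x t = z := by
  have := h.1.1
  rwa [zero_add] at this

theorem stayEvent_subset (h : B ⊆ C) (s t : ℕ) (z : V) : stayEvent B s t z ⊆ stayEvent C s t z :=
  fun _ hx => ⟨hx.1, fun i hi hi' => h (hx.2 i hi hi')⟩

/-- A path confined to `C ⊆ B'` up to time `s` cannot have left `B'` by an earlier time. -/
theorem shellEvent_inter_eq_empty (hCB' : C ⊆ B') {s t : ℕ} (hts : t ≤ s) (z z' : V) :
    shellEvent B C s z ∩ shellEvent B' C' t z' = ∅ := by
  rw [Set.eq_empty_iff_forall_notMem]
  rintro x ⟨h1, h2⟩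
  exact h2.2 ⟨h2.1.1, fun i hi hi' => hCB' (h1.1.2 i hi (by omega))⟩

/-- The path that follows `r` and is constant afterwards. -/
def extendPath {n : ℕ} (r : Fin (n + 1) → V) (i : ℕ) : V :=
  -- The value after time `n` is immaterial: it is only used for events determined up to time `n`.
  if h : i < n + 1 then r ⟨i, h⟩ else r 0

theorem toReal_srwStep {G : SimpleGraph V} [G.LocallyFinite] (u w : V) [Decidable (G.Adj u w)] :
    (srwStep G u w).toReal = if G.Adj u w then 1 / (G.degree u : ℝ) else 0 := by
  rw [srwStep]
  split_ifs <;> simp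

variable [MeasurableSpace V] [MeasurableSingletonClass V]

theorem measurableSet_eval_eq (n : ℕ) (w : V) : MeasurableSet {x : ℕ → V | x n = w} :=
  measurable_pi_apply (X := fun _ : ℕ => V) n (measurableSet_singleton w)

theorem measurableSet_cylinder_singleton (n : ℕ) (x : ℕ → V) :
    MeasurableSet {y : ℕ → V | ∀ i ≤ n, y i = x i} := by
  have : {y : ℕ → V | ∀ i ≤ n, y i = x i} = ⋂ i ≤ n, (fun y : ℕ → V => y i) ⁻¹' {x i} := by
    ext y; simp
  rw [this]
  exact MeasurableSet.iInter fun i => MeasurableSet.iInter fun _ =>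
    measurable_pi_apply i (measurableSet_singleton _)

theorem measurableSet_stayEvent (B : Finset V) (s t : ℕ) (z : V) :
    MeasurableSet (stayEvent B s t z) := by
  have : stayEvent B s t z = (fun y : ℕ → V => y (s + t)) ⁻¹' {z} ∩
      ⋂ i, ⋂ (_ : s ≤ i), ⋂ (_ : i ≤ s + t), (fun y : ℕ → V => y i) ⁻¹' (B : Set V) := by
    ext y; simp [stayEvent]
  rw [this]
  exact (measurable_pi_apply _ (measurableSet_singleton _)).inter <|
    MeasurableSet.iInter fun i => MeasurableSet.iInter fun _ => MeasurableSet.iInter fun _ =>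
      measurable_pi_apply i B.measurableSet

theorem measurableSet_shellEvent (t : ℕ) (z : V) : MeasurableSet (shellEvent B C t z) :=
  (measurableSet_stayEvent C 0 t z).diff (measurableSet_stayEvent B 0 t z)

variable {G : SimpleGraph V} [G.LocallyFinite] {v : V}

/-- The law on path space of a simple random walk makes the coordinate process a simple random
walk. -/
theorem IsSimpleRandomWalk.map_path {Ω : Type*} [MeasurableSpace Ω] {P : Measure Ω}
    {X : ℕ → Ω → V} (hX : IsSimpleRandomWalk G P v X) :
    IsSimpleRandomWalk G (P.map fun ω n => X n ω) v (fun n x => x n) := by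
  have hm : Measurable fun ω n => X n ω := measurable_pi_lambda _ hX.measurable
  refine ⟨fun n => measurable_pi_apply n, ?_, fun n x => ?_⟩
  · rw [ae_map_iff hm.aemeasurable]
    · exact hX.initial
    · exact measurableSet_eval_eq 0 v
  · rw [Measure.map_apply hm (measurableSet_cylinder_singleton _ _), Measure.map_apply hm (measurableSet_cylinder_singleton _ _)]
    exact hX.markov n x

variable [Countable V] {ν : Measure (ℕ → V)}

theorem measure_eq_tsum_cylinder (n : ℕ) {A : Set (ℕ → V)} (hA : MeasurableSet A) :
    ν A = ∑' r : Fin (n + 1) → V, ν (A ∩ {y | ∀ i ≤ n, y i = extendPath r i}) := by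
  rw [← measure_iUnion]
  · congr 1
    ext y
    simp only [Set.mem_iUnion, Set.mem_inter_iff, exists_and_left, Set.mem_ofPred_eq]
    refine ⟨fun h => ⟨h, fun i => y i, fun i hi => ?_⟩, fun h => h.1⟩
    rw [extendPath, dif_pos (by omega)]
  · intro r s hrs
    rw [Function.onFun, Set.disjoint_left]
    rintro y ⟨_, hr⟩ ⟨_, hs⟩
    apply hrs
    funext i
    have h1 := hr i (by omega)
    have h2 := hs i (by omega)
    rw [h1, extendPath, extendPath, dif_pos i.2, dif_pos i.2] at h2
    exact h2
  · exact fun r => hA.inter (measurableSet_cylinder_singleton n _)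

/-- The Markov property for arbitrary events of the past. -/
theorem IsSimpleRandomWalk.measure_inter_succ
    (hν : IsSimpleRandomWalk G ν v (fun n x => x n)) {n : ℕ} {A : Set (ℕ → V)}
    (hA : MeasurableSet A) (hdet : DeterminedBy n A) {u : V} (hu : ∀ x ∈ A, x n = u) (w : V) :
    ν (A ∩ {x | x (n + 1) = w}) = ν A * srwStep G u w := by
  classical
  have hw : MeasurableSet {x : ℕ → V | x (n + 1) = w} :=
    measurableSet_eval_eq (n + 1) w
  rw [measure_eq_tsum_cylinder n (hA.inter hw), measure_eq_tsum_cylinder n hA,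
    ← ENNReal.tsum_mul_right]
  refine tsum_congr fun r => ?_
  -- Each cylinder of length `n` is either contained in `A` or disjoint from it.
  by_cases hr : extendPath r ∈ A
  · have h1 : A ∩ {y | ∀ i ≤ n, y i = extendPath r i} = {y | ∀ i ≤ n, y i = extendPath r i} :=
      Set.inter_eq_right.2 fun y hy => hdet _ _ (fun i hi => (hy i hi).symm) hr
    have h2 : A ∩ {x | x (n + 1) = w} ∩ {y | ∀ i ≤ n, y i = extendPath r i} =
        {y | ∀ i ≤ n + 1, y i = Function.update (extendPath r) (n + 1) w i} := by
      ext y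
      simp only [Set.mem_inter_iff, Set.mem_ofPred_eq]
      constructor
      · rintro ⟨⟨_, h3⟩, h4⟩ i hi
        rcases Nat.lt_or_ge n i with h | h
        · obtain rfl : i = n + 1 := by omega
          rw [Function.update_self, h3]
        · rw [Function.update_of_ne (by omega), h4 i h]
      · intro h
        have h4 : ∀ i ≤ n, y i = extendPath r i := fun i hi => by
          rw [h i (by omega), Function.update_of_ne (by omega)]
        refine ⟨⟨hdet _ _ (fun i hi => (h4 i hi).symm) hr, ?_⟩, h4⟩
        rw [h _ le_rfl, Function.update_self]
    have h3 := hν.markov n (Function.update (extendPath r) (n + 1) w)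
    have h4 : {y : ℕ → V | ∀ i ≤ n, y i = Function.update (extendPath r) (n + 1) w i} =
        {y | ∀ i ≤ n, y i = extendPath r i} := by
      ext y
      simp only [Set.mem_ofPred_eq]
      refine forall₂_congr fun i hi => ?_
      rw [Function.update_of_ne (by omega)]
    rw [h1, h2, h3, h4, Function.update_self, Function.update_of_ne (by omega), hu _ hr]
  · have h1 : A ∩ {y | ∀ i ≤ n, y i = extendPath r i} = ∅ := by
      rw [Set.eq_empty_iff_forall_notMem]
      rintro y ⟨hy, h⟩
      exact hr (hdet _ _ h hy)
    have h2 : A ∩ {x | x (n + 1) = w} ∩ {y | ∀ i ≤ n, y i = extendPath r i} = ∅ := by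
      rw [Set.inter_right_comm, h1, Set.empty_inter]
    rw [h1, h2, measure_empty, zero_mul]

variable [IsProbabilityMeasure ν]

/-- The killed kernel gives the conditional probabilities of staying in a set. -/
theorem IsSimpleRandomWalk.measureReal_inter_stayEvent
    (hν : IsSimpleRandomWalk G ν v (fun n x => x n)) (B : Finset V) {s : ℕ} {A : Set (ℕ → V)}
    (hA : MeasurableSet A) (hdet : DeterminedBy s A) {z : V} (hz : ∀ x ∈ A, x s = z)
    (t : ℕ) (z' : V) :
    ν.real (A ∩ stayEvent B s t z') = ν.real A * G.killedKernel B t z z' := by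
  classical
  induction t generalizing z' with
  | zero =>
    by_cases h : z = z'
    · subst h
      by_cases hB : z ∈ B
      · rw [SimpleGraph.killedKernel_zero_self hB, mul_one]
        congr 1
        refine Set.inter_eq_left.2 fun x hx => ⟨hz x hx, fun i hi hi' => ?_⟩
        obtain rfl : i = s := by omega
        rwa [hz x hx]
      · rw [SimpleGraph.killedKernel_of_notMem_left hB, mul_zero]
        convert measureReal_empty (μ := ν)
        rw [Set.eq_empty_iff_forall_notMem]
        rintro x ⟨hx, _, h2⟩
        exact hB (hz x hx ▸ h2 s le_rfl le_rfl)
    · rw [SimpleGraph.killedKernel_zero_ne h, mul_zero]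
      convert measureReal_empty (μ := ν)
      rw [Set.eq_empty_iff_forall_notMem]
      rintro x ⟨hx, h1, _⟩
      exact h ((hz x hx).symm.trans h1)
  | succ t ih =>
    by_cases hB : z' ∈ B
    swap
    · rw [SimpleGraph.killedKernel_of_notMem_right hB, mul_zero]
      convert measureReal_empty (μ := ν)
      rw [Set.eq_empty_iff_forall_notMem]
      rintro x ⟨hx, h1, h2⟩
      exact hB (h1 ▸ h2 (s + (t + 1)) (by omega) le_rfl)
    have hU : A ∩ stayEvent B s (t + 1) z' =
        ⋃ w ∈ B, (A ∩ stayEvent B s t w) ∩ {x | x (s + t + 1) = z'} := by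
      ext x
      simp only [stayEvent, Set.mem_inter_iff, Set.mem_ofPred_eq, Set.mem_iUnion, exists_prop]
      constructor
      · rintro ⟨hx, h1, h2⟩
        exact ⟨x (s + t), h2 _ (by omega) (by omega),
          ⟨hx, rfl, fun i hi hi' => h2 i hi (by omega)⟩, h1⟩
      · rintro ⟨w, _, ⟨hx, _, h2⟩, h1⟩
        refine ⟨hx, h1, fun i hi hi' => ?_⟩
        rcases Nat.lt_or_ge (s + t) i with h | h
        · obtain rfl : i = s + t + 1 := by omega
          rwa [h1]
        · exact h2 i hi h
    rw [hU, measureReal_biUnion_finset]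
    · have hstep : ∀ w ∈ B, ν.real ((A ∩ stayEvent B s t w) ∩ {x | x (s + t + 1) = z'}) =
          ν.real A * (if w ∈ G.neighborFinset z' then
            G.killedKernel B t z w / G.degree w else 0) := by
        intro w _
        rw [measureReal_def, hν.measure_inter_succ (hA.inter (measurableSet_stayEvent B s t w))
          (hdet.inter (determinedBy_stayEvent B s t w) (by omega)) (fun x hx => hx.2.1) z',
          ENNReal.toReal_mul, ← measureReal_def, ih, toReal_srwStep]
        simp only [SimpleGraph.mem_neighborFinset, G.adj_comm z' w]
        split_ifs
        · ring
        · simp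
      rw [Finset.sum_congr rfl hstep, ← Finset.mul_sum, SimpleGraph.killedKernel_succ' hB,
        ← Finset.sum_filter]
      congr 1
      refine Finset.sum_subset (fun w hw => (Finset.mem_filter.1 hw).2) fun w hw hw' => ?_
      rw [SimpleGraph.killedKernel_of_notMem_right, zero_div]
      exact fun h => hw' (Finset.mem_filter.2 ⟨h, hw⟩)
    · intro w _ w' _ hww'
      rw [Function.onFun, Set.disjoint_left]
      rintro x ⟨⟨_, h1, _⟩, _⟩ ⟨⟨_, h2, _⟩, _⟩
      exact hww' (h1.symm.trans h2)
    · exact fun w _ => (hA.inter (measurableSet_stayEvent B s t w)).inter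
        (measurableSet_eval_eq (s + t + 1) z')

theorem IsSimpleRandomWalk.measureReal_shellEvent
    (hν : IsSimpleRandomWalk G ν v (fun n x => x n)) (hBC : B ⊆ C) (t : ℕ) (z : V) :
    ν.real (shellEvent B C t z) = G.shellKernel B C t v z := by
  have h0 : MeasurableSet {x : ℕ → V | x 0 = v} :=
    measurableSet_eval_eq 0 v
  have h1 : ν.real {x : ℕ → V | x 0 = v} = 1 := by
    rw [measureReal_def, (prob_compl_eq_zero_iff h0).1]
    · simp
    · exact hν.initial
  have h2 : ∀ D : Finset V, ν.real (stayEvent D 0 t z) = G.killedKernel D t v z := by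
    intro D
    have h3 := hν.measureReal_inter_stayEvent D h0
      (fun x y h hx => (h 0 le_rfl).symm.trans hx) (fun x hx => hx) t z
    rw [h1, one_mul] at h3
    rw [← h3]
    refine measureReal_congr ?_
    filter_upwards [hν.initial] with x hx
    refine propext ⟨fun h => ⟨hx, h⟩, fun h => h.2⟩
  rw [shellEvent, measureReal_sdiff (stayEvent_subset hBC 0 t z) (measurableSet_stayEvent B 0 t z),
    h2, h2, SimpleGraph.shellKernel]

theorem IsSimpleRandomWalk.measureReal_shellEvent_inter_le
    (hν : IsSimpleRandomWalk G ν v (fun n x => x n)) (hBC : B ⊆ C) (s t : ℕ) (z z' : V) :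
    ν.real (shellEvent B C s z ∩ shellEvent B C (s + t) z') ≤
      G.shellKernel B C s v z * G.killedKernel C t z z' := by
  rw [← hν.measureReal_shellEvent hBC, ← hν.measureReal_inter_stayEvent C
    (measurableSet_shellEvent s z) (determinedBy_shellEvent s z)
    (fun x hx => apply_of_mem_shellEvent hx) t z']
  refine measureReal_mono fun x hx => ⟨hx.1, apply_of_mem_shellEvent hx.2, fun i _ hi => ?_⟩
  exact hx.2.1.2 i (Nat.zero_le i) (by omega)

/-- Up to time `s` the path is in `C ⊆ B'`, so it must leave `B'` after time `s`; the Markov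
property at `s` then gives the product. -/
theorem IsSimpleRandomWalk.measureReal_shellEvent_inter_le_of_subset
    (hν : IsSimpleRandomWalk G ν v (fun n x => x n)) (hBC : B ⊆ C) (hCB' : C ⊆ B')
    (hBC' : B' ⊆ C') (s t : ℕ) (z z' : V) :
    ν.real (shellEvent B C s z ∩ shellEvent B' C' (s + t) z') ≤
      G.shellKernel B C s v z * G.shellKernel B' C' t z z' := by
  have hm := measurableSet_shellEvent (B := B) (C := C) s z
  have h : ∀ D, _ := fun D => hν.measureReal_inter_stayEvent D hm (determinedBy_shellEvent s z)
    (fun x hx => apply_of_mem_shellEvent hx) t z'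
  rw [← hν.measureReal_shellEvent hBC, SimpleGraph.shellKernel, mul_sub, ← h, ← h,
    ← measureReal_sdiff (Set.inter_subset_inter_right _ (stayEvent_subset hBC' s t z'))
      (hm.inter (measurableSet_stayEvent B' s t z'))]
  refine measureReal_mono fun x hx => ⟨⟨hx.1, apply_of_mem_shellEvent hx.2, fun i _ hi =>
    hx.2.1.2 i (Nat.zero_le i) (by omega)⟩, fun hx' => hx.2.2 ⟨hx.2.1.1, fun i _ hi => ?_⟩⟩
  rcases le_total i s with h | h
  · exact hCB' (hx.1.1.2 i (Nat.zero_le i) (by omega))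
  · exact hx'.2.2 i h (by omega)

end PathSpace

/-! ### The second moment criterion and moments of counts of common events. -/

section SecondMoment

theorem sum_ite_le_sum_shift {h : ℕ → ℝ} (hh : ∀ t, 0 ≤ h t) (s T : ℕ) :
    ∑ t ∈ Finset.range T, (if s ≤ t then h t else 0) ≤ ∑ r ∈ Finset.range T, h (s + r) := by
  rw [← Finset.sum_filter, ← Finset.sum_image (f := h) (g := fun r => s + r)
    (fun a _ b _ hab => by simpa using hab)]
  refine Finset.sum_le_sum_of_subset_of_nonneg ?_ fun _ _ _ => hh _
  intro t ht
  rw [Finset.mem_filter, Finset.mem_range] at ht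
  exact Finset.mem_image.2 ⟨t - s, Finset.mem_range.2 (by omega), by omega⟩

theorem sum_sum_le_of_symm {g : ℕ → ℕ → ℝ} (hg : ∀ s t, 0 ≤ g s t) (hs : ∀ s t, g s t = g t s)
    (T : ℕ) : ∑ s ∈ Finset.range T, ∑ t ∈ Finset.range T, g s t ≤
      2 * ∑ s ∈ Finset.range T, ∑ r ∈ Finset.range T, g s (s + r) := by
  have h1 : ∑ s ∈ Finset.range T, ∑ t ∈ Finset.range T, g s t ≤
      ∑ s ∈ Finset.range T, ∑ t ∈ Finset.range T, (if s ≤ t then g s t else 0) +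
      ∑ s ∈ Finset.range T, ∑ t ∈ Finset.range T, (if t ≤ s then g t s else 0) := by
    rw [← Finset.sum_add_distrib]
    refine Finset.sum_le_sum fun s _ => ?_
    rw [← Finset.sum_add_distrib]
    refine Finset.sum_le_sum fun t _ => ?_
    have := hg s t
    have := hg t s
    rcases le_total s t with h | h
    · rw [if_pos h]; split_ifs <;> linarith
    · rw [if_pos h, hs t s]; split_ifs <;> linarith
  rw [Finset.sum_comm (f := fun s t => if t ≤ s then g t s else 0), ← two_mul] at h1
  refine h1.trans (mul_le_mul_of_nonneg_left ?_ zero_le_two)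
  exact Finset.sum_le_sum fun s _ => sum_ite_le_sum_shift (hg s) s T

/-- A second moment criterion: nonnegatively correlated terms with summably decaying excess
correlations have almost surely unbounded partial sums if the means have. -/
theorem measure_forall_sum_le_eq_zero {Ω : Type*} [MeasurableSpace Ω] {μ : Measure Ω}
    [IsProbabilityMeasure μ] {Y : ℕ → Ω → ℝ} {b : ℕ → ℝ} {M : ℝ}
    (hY : ∀ k, Integrable (Y k) μ) (hYY : ∀ j k, Integrable (fun ω => Y j ω * Y k ω) μ)
    (hb : ∀ k, ∫ ω, Y k ω ∂μ = b k) (hb0 : ∀ k, 0 ≤ b k) (hM : 0 ≤ M)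
    (hcov : ∀ j r, ∫ ω, Y j ω * Y (j + r) ω ∂μ ≤ b j * b (j + r) + M * b j * (1 / 2) ^ r)
    (hdiv : Tendsto (fun K => ∑ k ∈ Finset.range K, b k) atTop atTop) (c : ℝ) :
    μ {ω | ∀ K, ∑ k ∈ Finset.range K, Y k ω ≤ c} = 0 := by
  have hDsq : ∀ (K : ℕ) (ω : Ω), (∑ k ∈ Finset.range K, (Y k ω - b k)) ^ 2 =
      ∑ j ∈ Finset.range K, ∑ k ∈ Finset.range K,
        (Y j ω * Y k ω - b k * Y j ω - b j * Y k ω + b j * b k) := by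
    intro K ω
    rw [sq, Finset.sum_mul_sum]
    refine Finset.sum_congr rfl fun j _ => Finset.sum_congr rfl fun k _ => ?_
    ring
  have hi : ∀ j k, Integrable (fun ω => Y j ω * Y k ω - b k * Y j ω - b j * Y k ω + b j * b k) μ :=
    fun j k => (((hYY j k).sub ((hY j).const_mul _)).sub ((hY k).const_mul _)).add
      (integrable_const _)
  have hDint : ∀ K, Integrable (fun ω => (∑ k ∈ Finset.range K, (Y k ω - b k)) ^ 2) μ := by
    intro K
    simp only [hDsq]
    exact integrable_finsetSum _ fun j _ => integrable_finsetSum _ fun k _ => hi j k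
  have hcov' : ∀ j k, ∫ ω, (Y j ω * Y k ω - b k * Y j ω - b j * Y k ω + b j * b k) ∂μ =
      ∫ ω, Y j ω * Y k ω ∂μ - b j * b k := by
    intro j k
    have i1 : Integrable (fun ω => Y j ω * Y k ω - b k * Y j ω) μ :=
      (hYY j k).sub ((hY j).const_mul _)
    have i2 : Integrable (fun ω => Y j ω * Y k ω - b k * Y j ω - b j * Y k ω) μ :=
      i1.sub ((hY k).const_mul _)
    rw [integral_add i2 (integrable_const _), integral_sub i1 ((hY k).const_mul _),
      integral_sub (hYY j k) ((hY j).const_mul _), integral_const_mul, integral_const_mul, hb, hb]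
    simp
    ring
  have hvar : ∀ K, ∫ ω, (∑ k ∈ Finset.range K, (Y k ω - b k)) ^ 2 ∂μ ≤
      4 * M * ∑ k ∈ Finset.range K, b k := by
    intro K
    simp only [hDsq]
    rw [integral_finsetSum _ fun j _ => integrable_finsetSum _ fun k _ => hi j k]
    have h1 : ∀ j, ∫ ω, ∑ k ∈ Finset.range K,
        (Y j ω * Y k ω - b k * Y j ω - b j * Y k ω + b j * b k) ∂μ =
        ∑ k ∈ Finset.range K, (∫ ω, Y j ω * Y k ω ∂μ - b j * b k) := by
      intro j
      rw [integral_finsetSum _ fun k _ => hi j k]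
      exact Finset.sum_congr rfl fun k _ => hcov' j k
    simp only [h1]
    -- Covariances are only bounded above, so their positive parts are summed.
    set w : ℕ → ℕ → ℝ := fun j k => max 0 (∫ ω, Y j ω * Y k ω ∂μ - b j * b k) with hw
    have h2 := sum_sum_le_of_symm (g := w) (fun j k => le_max_left _ _)
      (fun j k => by simp only [hw, mul_comm]) K
    have h3 : ∀ j, ∑ r ∈ Finset.range K, w j (j + r) ≤ 2 * M * b j := by
      intro j
      have h4 : ∀ r ∈ Finset.range K, w j (j + r) ≤ M * b j * (1 / 2) ^ r := by
        intro r _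
        refine max_le ?_ (by linarith [hcov j r])
        have := hb0 j
        positivity
      refine (Finset.sum_le_sum h4).trans ?_
      rw [← Finset.mul_sum]
      have h5 := sum_geometric_two_le (K)
      have h6 : 0 ≤ M * b j := mul_nonneg hM (hb0 j)
      nlinarith
    calc ∑ j ∈ Finset.range K, ∑ k ∈ Finset.range K, (∫ ω, Y j ω * Y k ω ∂μ - b j * b k)
        ≤ ∑ j ∈ Finset.range K, ∑ k ∈ Finset.range K, w j k :=
          Finset.sum_le_sum fun j _ => Finset.sum_le_sum fun k _ => le_max_right _ _
      _ ≤ 2 * ∑ j ∈ Finset.range K, ∑ r ∈ Finset.range K, w j (j + r) := h2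
      _ ≤ 2 * ∑ j ∈ Finset.range K, 2 * M * b j :=
          mul_le_mul_of_nonneg_left (Finset.sum_le_sum fun j _ => h3 j) zero_le_two
      _ = 4 * M * ∑ k ∈ Finset.range K, b k := by rw [← Finset.mul_sum]; ring
  set A := {ω | ∀ K, ∑ k ∈ Finset.range K, Y k ω ≤ c}
  -- Once the mean exceeds `2 |c|`, staying below `c` is a deviation of at least half the mean, to
  -- which Chebyshev's inequality applies.
  have hle : ∀ K, 2 * |c| + 1 ≤ ∑ k ∈ Finset.range K, b k →
      μ.real A ≤ 16 * M * (∑ k ∈ Finset.range K, b k)⁻¹ := by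
    intro K hK
    set S := ∑ k ∈ Finset.range K, b k
    have hc := le_abs_self c
    have hc0 := abs_nonneg c
    have hS : 0 < S := by linarith
    have h1 := mul_meas_ge_le_integral_of_nonneg
      (ae_of_all μ fun ω => sq_nonneg (∑ k ∈ Finset.range K, (Y k ω - b k))) (hDint K) ((S / 2) ^ 2)
    have h2 : A ⊆ {ω | (S / 2) ^ 2 ≤ (∑ k ∈ Finset.range K, (Y k ω - b k)) ^ 2} := by
      intro ω hω
      have h3 := hω K
      rw [Set.mem_ofPred_eq, Finset.sum_sub_distrib]
      change (S / 2) ^ 2 ≤ (_ - S) ^ 2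
      nlinarith
    have h4 : (S / 2) ^ 2 * μ.real A ≤ 4 * M * S :=
      (mul_le_mul_of_nonneg_left (measureReal_mono h2) (sq_nonneg _)).trans (h1.trans (hvar K))
    rw [← div_eq_mul_inv, le_div_iff₀ hS]
    have h5 : S * (μ.real A * S) ≤ S * (16 * M) := by linarith
    exact le_of_mul_le_mul_left h5 hS
  have hlim : Tendsto (fun K => 16 * M * (∑ k ∈ Finset.range K, b k)⁻¹) atTop (nhds 0) := by
    simpa using (tendsto_inv_atTop_zero.comp hdiv).const_mul (16 * M)
  have h0 : μ.real A ≤ 0 :=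
    ge_of_tendsto hlim ((hdiv.eventually_ge_atTop _).mono fun K hK => hle K hK)
  exact (measureReal_eq_zero_iff).1 (le_antisymm h0 measureReal_nonneg)

variable {α ι κ : Type*} {I : Finset ι} {J : Finset κ} {A : ι → Set α} {A' : κ → Set α}

/-- The number of events of a family that occur for both entries of a pair. -/
noncomputable def pairCount (I : Finset ι) (A : ι → Set α) (p : α × α) : ℝ :=
  ∑ i ∈ I, (A i ×ˢ A i).indicator 1 p

/-- Products of counts are again counts, so `integral_pairCount` also gives second moments. -/
theorem pairCount_mul (p : α × α) : pairCount I A p * pairCount J A' p =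
    pairCount (I ×ˢ J) (fun q => A q.1 ∩ A' q.2) p := by
  simp only [pairCount]
  rw [Finset.sum_mul_sum, Finset.sum_product]
  refine Finset.sum_congr rfl fun i _ => Finset.sum_congr rfl fun j _ => ?_
  rw [← Set.prod_inter_prod, Set.inter_indicator_one, Pi.mul_apply]

variable [MeasurableSpace α] {μ ν : Measure α} [IsProbabilityMeasure μ] [IsProbabilityMeasure ν]

theorem integrable_indicator_prod {s : Set α} (hs : MeasurableSet s) :
    Integrable ((s ×ˢ s).indicator (1 : α × α → ℝ)) (μ.prod ν) :=
  (integrable_const (1 : ℝ)).indicator (hs.prod hs)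

theorem integrable_pairCount (hA : ∀ i, MeasurableSet (A i)) :
    Integrable (pairCount I A) (μ.prod ν) :=
  integrable_finsetSum _ fun i _ => integrable_indicator_prod (hA i)

theorem integral_pairCount (hA : ∀ i, MeasurableSet (A i)) :
    ∫ p, pairCount I A p ∂(μ.prod ν) = ∑ i ∈ I, μ.real (A i) * ν.real (A i) := by
  simp only [pairCount]
  rw [integral_finsetSum _ fun i _ => integrable_indicator_prod (hA i)]
  refine Finset.sum_congr rfl fun i _ => ?_
  rw [integral_indicator_one ((hA i).prod (hA i)), measureReal_prod_prod]

end SecondMoment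

/-! ### Level counts, their moments and the conclusion. -/

section Collisions

theorem runningMax_mono (f : ℤ → ℝ) : Monotone (runningMax f) := by
  intro m n hmn
  refine max_le_max le_rfl (Finset.sup'_mono f ?_ _)
  exact Finset.Icc_subset_Icc (by omega) (by omega)

/-- Condensation of the divergence condition along a geometric sequence of scales. -/
theorem tendsto_sum_min_runningMax {f : ℤ → ℝ}
    (hdiv : Tendsto (fun N : ℕ => ∑ n ∈ Finset.Icc 1 N, 1 / runningMax f n) atTop atTop) (k₀ : ℕ) :
    Tendsto (fun K => ∑ k ∈ Finset.range K,
      min 1 (((64 ^ (k + k₀) : ℕ) : ℝ) / runningMax f (64 ^ (k + k₀)))) atTop atTop := by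
  have hpos : ∀ n, 0 < runningMax f n := fun n => zero_lt_one.trans_le (Comb.one_le_runningMax f n)
  rw [← not_summable_iff_tendsto_nat_atTop_of_nonneg
    fun k => le_min zero_le_one (div_nonneg (Nat.cast_nonneg _) (hpos _).le)]
  intro hs
  -- A convergent series has terms eventually below one, where the minimum is the ratio itself.
  have hs' : Summable fun k : ℕ => ((64 ^ (k + k₀) : ℕ) : ℝ) / runningMax f (64 ^ (k + k₀)) := by
    have hev := hs.tendsto_atTop_zero.eventually (gt_mem_nhds zero_lt_one)
    obtain ⟨K, hK⟩ := eventually_atTop.1 hev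
    rw [← summable_nat_add_iff K] at hs ⊢
    refine hs.congr fun k => min_eq_right ?_
    have := hK (k + K) (by omega)
    exact (lt_of_not_ge fun h => by rw [min_eq_left h] at this; exact lt_irrefl _ this).le
  rw [summable_nat_add_iff (f := fun k : ℕ => ((64 ^ k : ℕ) : ℝ) / runningMax f (64 ^ k)) k₀] at hs'
  have hsum : Summable fun n : ℕ => 1 / runningMax f n := by
    rw [← summable_schlomilch_iff_of_nonneg (C := 64) (u := fun k => 64 ^ k)
      (fun n => (one_div_pos.2 (hpos n)).le)
      (fun m n _ hmn => one_div_le_one_div_of_le (hpos m) (runningMax_mono f hmn))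
      (fun n => by positivity) (pow_right_strictMono₀ (by norm_num)) (by norm_num)
      (fun n => by simp only [smul_eq_mul]; rw [pow_succ, pow_succ]; omega)]
    refine (hs'.mul_left 63).congr fun k => ?_
    push_cast
    ring
  obtain ⟨N, hN⟩ := (hdiv.eventually_gt_atTop (∑' n, 1 / runningMax f n)).exists
  exact absurd (hsum.sum_le_tsum (Finset.Icc 1 N) fun n _ => (one_div_pos.2 (hpos n)).le)
    (not_le.2 hN)

namespace Comb

variable {f : ℤ → ℝ}

/-- The number of collisions before time `T`, at height at most `64 n`, that happen while both walks
have left the columns `-n, …, n` but not the columns `-64 n, …, 64 n`. -/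
noncomputable def levelCount (f : ℤ → ℝ) (n T : ℕ) :
    (ℕ → CombVertex f) × (ℕ → CombVertex f) → ℝ :=
  pairCount (Finset.range T ×ˢ lowBox f (64 * n))
    fun q => shellEvent (box f n) (box f (64 * n)) q.1 q.2

/-- The expected number of the collisions counted by `levelCount`. -/
noncomputable def levelEnergy (f : ℤ → ℝ) (n T : ℕ) (v : CombVertex f) : ℝ :=
  (Comb f).shellEnergy (box f n) (box f (64 * n)) (lowBox f (64 * n)) T v

theorem levelEnergy_nonneg (n T : ℕ) (v : CombVertex f) : 0 ≤ levelEnergy f n T v :=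
  SimpleGraph.shellEnergy_nonneg _ _ _

theorem box_subset (n : ℕ) : box f n ⊆ box f (64 * n) := box_mono (by omega)

theorem levelEnergy_le (hf : ∀ i, 0 ≤ f i) {n : ℕ} (hn : 1 ≤ n) (T : ℕ) {u : CombVertex f}
    (hu : u ∈ lowBox f n) : levelEnergy f n T u ≤ 18 ^ 2 * n := by
  rw [mem_lowBox] at hu
  have h1 := (SimpleGraph.shellEnergy_le (box_subset (f := f) n)
    (lowBox_subset (64 * n)) T u).trans
    (sum_sum_killedKernel_sq_le hf (box_subset n (mem_box.2 hu.1)) T)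
  have h2 : |(u.1.2 : ℝ)| ≤ n := by exact_mod_cast hu.2
  have h3 : (1 : ℝ) ≤ n := by exact_mod_cast hn
  push_cast at h1
  rw [levelEnergy]
  linarith

/-- Squaring the root comparison: as the energy from `v` is at most `18 ^ 2 * n`, the cross term is
also of order `j`, and `144 * 18 + 72 ^ 2 = 7776`. An error of order `j` rather than `n` is what
decorrelates distant levels. -/
theorem levelEnergy_le_add (hf : ∀ i, 0 ≤ f i) {v : CombVertex f} {j n : ℕ}
    (hj : 2 * (|v.1.1| + |v.1.2|) + 1 ≤ j) (hjn : j ≤ n) (T : ℕ) {u : CombVertex f}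
    (hu : u ∈ lowBox f j) :
    levelEnergy f n T u ≤ levelEnergy f n T v + 7776 * j := by
  have ha := abs_nonneg v.1.1
  have hh := abs_nonneg v.1.2
  have hn1 : 1 ≤ n := by omega
  have hn : (0 : ℝ) < n := by exact_mod_cast hn1
  have key := sqrt_shellEnergy_lowBox_le hf hj hjn T hu
  have hv := levelEnergy_le hf hn1 T (u := v) (mem_lowBox.2 ⟨by omega, by omega⟩)
  change √(levelEnergy f n T u) ≤ √(levelEnergy f n T v) + _ at key
  have hu0 := levelEnergy_nonneg n T u
  have hv0 := levelEnergy_nonneg n T v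
  have hsv := Real.sqrt_le_sqrt hv
  rw [Real.sqrt_mul (by norm_num), Real.sqrt_sq (by norm_num)] at hsv
  rw [← Real.sq_sqrt hu0, ← Real.sq_sqrt hv0]
  have hρ : (j : ℝ) / n ≤ 1 := by rw [div_le_one hn]; exact_mod_cast hjn
  have hρ0 : 0 ≤ (j : ℝ) / n := by positivity
  have hj' : (j : ℝ) = √n * √n * (j / n) := by
    rw [Real.mul_self_sqrt hn.le]; field_simp
  set a := √(levelEnergy f n T u)
  set b := √(levelEnergy f n T v)
  set r := √(n : ℝ)
  set ρ := (j : ℝ) / n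
  rw [hj']
  have ha0 : 0 ≤ a := Real.sqrt_nonneg _
  have hb0 : 0 ≤ b := Real.sqrt_nonneg _
  have hr0 : 0 ≤ r := Real.sqrt_nonneg _
  calc a ^ 2 ≤ (b + 72 * r * ρ) ^ 2 := pow_le_pow_left₀ ha0 key 2
    _ = b ^ 2 + 144 * (r * ρ) * b + 5184 * (r * r * ρ) * ρ := by ring
    _ ≤ b ^ 2 + 144 * (r * ρ) * (18 * r) + 5184 * (r * r * ρ) * 1 := by gcongr
    _ = b ^ 2 + 7776 * (r * r * ρ) := by ring

variable {v : CombVertex f} {μ ν : Measure (ℕ → CombVertex f)} [IsProbabilityMeasure μ]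
  [IsProbabilityMeasure ν]

theorem integrable_levelCount (n T : ℕ) : Integrable (levelCount f n T) (μ.prod ν) :=
  integrable_pairCount fun _ => measurableSet_shellEvent _ _

theorem integrable_levelCount_mul (m n T T' : ℕ) :
    Integrable (fun p => levelCount f m T p * levelCount f n T' p) (μ.prod ν) := by
  simp only [levelCount, pairCount_mul]
  exact integrable_pairCount
    (A := fun q : (ℕ × CombVertex f) × (ℕ × CombVertex f) =>
      shellEvent (box f m) (box f (64 * m)) q.1.1 q.1.2 ∩
        shellEvent (box f n) (box f (64 * n)) q.2.1 q.2.2)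
    fun q => (measurableSet_shellEvent _ _).inter (measurableSet_shellEvent _ _)

theorem integral_levelCount (hμ : IsSimpleRandomWalk (Comb f) μ v (fun n x => x n))
    (hν : IsSimpleRandomWalk (Comb f) ν v (fun n x => x n)) (n T : ℕ) :
    ∫ p, levelCount f n T p ∂(μ.prod ν) = levelEnergy f n T v := by
  rw [levelCount, integral_pairCount fun q => measurableSet_shellEvent _ _, Finset.sum_product,
    levelEnergy, SimpleGraph.shellEnergy]
  refine Finset.sum_congr rfl fun t _ => Finset.sum_congr rfl fun z _ => ?_
  rw [hμ.measureReal_shellEvent (box_subset n), hν.measureReal_shellEvent (box_subset n), sq]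

/-- After a collision at `z`, the expected number of further ones is at most that of walks restarted
at `z`, hence `O(n)`. The height cap `|z.1.2| ≤ 64 n` is essential here. -/
theorem integral_levelCount_sq_le (hf : ∀ i, 0 ≤ f i)
    (hμ : IsSimpleRandomWalk (Comb f) μ v (fun n x => x n))
    (hν : IsSimpleRandomWalk (Comb f) ν v (fun n x => x n)) {n : ℕ} (hn : 1 ≤ n) (T : ℕ) :
    ∫ p, levelCount f n T p * levelCount f n T p ∂(μ.prod ν) ≤
      1032 * n * levelEnergy f n T v := by
  simp only [levelCount, pairCount_mul]
  rw [integral_pairCount fun q => (measurableSet_shellEvent _ _).inter (measurableSet_shellEvent _ _)]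
  simp only [Finset.sum_product]
  set A := fun (t : ℕ) (z : CombVertex f) => shellEvent (box f n) (box f (64 * n)) t z with hA
  set S := lowBox f (64 * n) with hS
  set g : ℕ → ℕ → ℝ := fun s t => ∑ z ∈ S, ∑ z' ∈ S,
    μ.real (A s z ∩ A t z') * ν.real (A s z ∩ A t z') with hg
  have h1 : ∑ s ∈ Finset.range T, ∑ z ∈ S, ∑ t ∈ Finset.range T, ∑ z' ∈ S,
      μ.real (A s z ∩ A t z') * ν.real (A s z ∩ A t z') =
      ∑ s ∈ Finset.range T, ∑ t ∈ Finset.range T, g s t :=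
    Finset.sum_congr rfl fun s _ => Finset.sum_comm
  have h2 := sum_sum_le_of_symm (g := g)
    (fun s t => Finset.sum_nonneg fun _ _ => Finset.sum_nonneg fun _ _ =>
      mul_nonneg measureReal_nonneg measureReal_nonneg)
    (fun s t => by
      simp only [hg]
      rw [Finset.sum_comm]
      refine Finset.sum_congr rfl fun z _ => Finset.sum_congr rfl fun z' _ => ?_
      rw [Set.inter_comm]) T
  refine h1.trans_le (h2.trans ?_)
  have h3 : ∀ s, ∑ r ∈ Finset.range T, g s (s + r) ≤
      ∑ z ∈ S, (Comb f).shellKernel (box f n) (box f (64 * n)) s v z ^ 2 * (516 * n) := by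
    intro s
    rw [Finset.sum_comm]
    refine Finset.sum_le_sum fun z hz => ?_
    rw [hS, mem_lowBox] at hz
    have h4 := sum_sum_killedKernel_sq_le hf (mem_box.2 hz.1) T
    have h5 : |(z.1.2 : ℝ)| ≤ (64 * n : ℕ) := by exact_mod_cast hz.2
    have h6 : (1 : ℝ) ≤ n := by exact_mod_cast hn
    push_cast at h4 h5
    have h7 : ∑ t ∈ Finset.range T, ∑ z' ∈ S,
        (Comb f).killedKernel (box f (64 * n)) t z z' ^ 2 ≤ 516 * n := by
      refine le_trans (Finset.sum_le_sum fun t _ =>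
        Finset.sum_le_sum_of_subset_of_nonneg (lowBox_subset _) fun _ _ _ => sq_nonneg _)
        (h4.trans ?_)
      linarith
    refine le_trans ?_ (mul_le_mul_of_nonneg_left h7 (sq_nonneg _))
    rw [Finset.mul_sum]
    refine Finset.sum_le_sum fun r _ => ?_
    rw [Finset.mul_sum]
    refine Finset.sum_le_sum fun z' _ => ?_
    rw [← mul_pow, sq]
    have hk := SimpleGraph.killedKernel_nonneg (G := Comb f) (B := box f (64 * n)) r z z'
    have hd := SimpleGraph.shellKernel_nonneg (G := Comb f) (box_subset (f := f) n) s v z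
    exact mul_le_mul (hμ.measureReal_shellEvent_inter_le (box_subset n) s r z z')
      (hν.measureReal_shellEvent_inter_le (box_subset n) s r z z') measureReal_nonneg
      (mul_nonneg hd hk)
  refine (mul_le_mul_of_nonneg_left (Finset.sum_le_sum fun s _ => h3 s) zero_le_two).trans
    (le_of_eq ?_)
  simp only [← Finset.sum_mul]
  rw [levelEnergy, SimpleGraph.shellEnergy]
  ring

/-- Given a collision of level `m` at `z`, those of level `n` come later and have conditional mean
at most the level energy from `z`, which is compared with that from `v`. -/
theorem integral_levelCount_mul_le (hf : ∀ i, 0 ≤ f i)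
    (hμ : IsSimpleRandomWalk (Comb f) μ v (fun n x => x n))
    (hν : IsSimpleRandomWalk (Comb f) ν v (fun n x => x n)) {m n : ℕ}
    (hm : 2 * (|v.1.1| + |v.1.2|) + 1 ≤ m) (hmn : 64 * m ≤ n) (T T' : ℕ) :
    ∫ p, levelCount f m T p * levelCount f n T' p ∂(μ.prod ν) ≤
      levelEnergy f m T v * (levelEnergy f n T' v + 7776 * (64 * m)) := by
  simp only [levelCount, pairCount_mul]
  rw [integral_pairCount fun q => (measurableSet_shellEvent _ _).inter (measurableSet_shellEvent _ _)]
  simp only [Finset.sum_product]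
  rw [levelEnergy, SimpleGraph.shellEnergy, Finset.sum_mul]
  refine Finset.sum_le_sum fun s _ => ?_
  rw [Finset.sum_mul]
  refine Finset.sum_le_sum fun z hz => ?_
  have hsub : box f (64 * m) ⊆ box f n := box_mono hmn
  have hE := levelEnergy_le_add hf (v := v) (j := 64 * m) (by push_cast; omega) hmn T' hz
  push_cast at hE
  refine le_trans ?_ (mul_le_mul_of_nonneg_left hE (sq_nonneg _))
  set h : ℕ → ℝ := fun t => ∑ z' ∈ lowBox f (64 * n),
    μ.real (shellEvent (box f m) (box f (64 * m)) s z ∩ shellEvent (box f n) (box f (64 * n)) t z') *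
    ν.real (shellEvent (box f m) (box f (64 * m)) s z ∩ shellEvent (box f n) (box f (64 * n)) t z')
    with hh
  have h1 : ∀ t, h t = if s ≤ t then h t else 0 := by
    intro t
    split_ifs with hst
    · rfl
    · refine Finset.sum_eq_zero fun z' _ => ?_
      rw [shellEvent_inter_eq_empty hsub (by omega), measureReal_empty, zero_mul]
  calc ∑ t ∈ Finset.range T', h t
      = ∑ t ∈ Finset.range T', (if s ≤ t then h t else 0) :=
        Finset.sum_congr rfl fun t _ => h1 t
    _ ≤ ∑ r ∈ Finset.range T', h (s + r) :=
        sum_ite_le_sum_shift (fun t => Finset.sum_nonneg fun _ _ =>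
          mul_nonneg measureReal_nonneg measureReal_nonneg) s T'
    _ ≤ _ := by
      rw [levelEnergy, SimpleGraph.shellEnergy, Finset.mul_sum]
      refine Finset.sum_le_sum fun r _ => ?_
      rw [Finset.mul_sum]
      refine Finset.sum_le_sum fun z' _ => ?_
      rw [← mul_pow, sq]
      exact mul_le_mul
        (hμ.measureReal_shellEvent_inter_le_of_subset (box_subset m) hsub (box_subset n) s r z z')
        (hν.measureReal_shellEvent_inter_le_of_subset (box_subset m) hsub (box_subset n) s r z z')
        measureReal_nonneg
        (mul_nonneg (SimpleGraph.shellKernel_nonneg (box_subset m) _ _ _)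
          (SimpleGraph.shellKernel_nonneg (box_subset n) _ _ _))

/-- The time of a collision determines its place, so each time is counted at most once. -/
theorem levelCount_le_ncard (n T : ℕ) {p : (ℕ → CombVertex f) × (ℕ → CombVertex f)}
    (hp : {t | p.1 t = p.2 t}.Finite) : levelCount f n T p ≤ {t | p.1 t = p.2 t}.ncard := by
  classical
  rw [levelCount, pairCount, Finset.sum_product]
  have h1 : ∀ t, ∑ z ∈ lowBox f (64 * n), (shellEvent (box f n) (box f (64 * n)) t z ×ˢ
      shellEvent (box f n) (box f (64 * n)) t z).indicator (1 : (ℕ → CombVertex f) × (ℕ → CombVertex f) → ℝ) p ≤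
      if t ∈ hp.toFinset then 1 else 0 := by
    intro t
    have h2 : ∀ z, (shellEvent (box f n) (box f (64 * n)) t z ×ˢ
        shellEvent (box f n) (box f (64 * n)) t z).indicator (1 : (ℕ → CombVertex f) × (ℕ → CombVertex f) → ℝ) p ≤
        if z = p.1 t then (if t ∈ hp.toFinset then 1 else 0) else 0 := by
      intro z
      by_cases h : p ∈ shellEvent (box f n) (box f (64 * n)) t z ×ˢ
        shellEvent (box f n) (box f (64 * n)) t z
      · have e1 := apply_of_mem_shellEvent h.1
        have e2 := apply_of_mem_shellEvent h.2
        rw [Set.indicator_of_mem h, if_pos e1.symm, if_pos (by simp [e1, e2])]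
        rfl
      · rw [Set.indicator_of_notMem h]
        split_ifs <;> norm_num
    refine (Finset.sum_le_sum fun z _ => h2 z).trans ?_
    rw [Finset.sum_ite_eq']
    split_ifs <;> norm_num
  refine (Finset.sum_le_sum fun t _ => h1 t).trans ?_
  rw [← Finset.sum_filter, Finset.sum_const, nsmul_eq_mul, mul_one, Set.ncard_eq_toFinset_card _ hp]
  exact_mod_cast Finset.card_le_card fun t ht => (Finset.mem_filter.1 ht).2

theorem ae_infinite_collisions (hf : ∀ i, 0 ≤ f i)
    (hdiv : Tendsto (fun N : ℕ => ∑ n ∈ Finset.Icc 1 N, 1 / runningMax f n) atTop atTop)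
    (hμ : IsSimpleRandomWalk (Comb f) μ v (fun n x => x n))
    (hν : IsSimpleRandomWalk (Comb f) ν v (fun n x => x n)) :
    ∀ᵐ p ∂(μ.prod ν), {t | p.1 t = p.2 t}.Infinite := by
  obtain ⟨k₀, hk₀⟩ : ∃ k₀ : ℕ, 2 * (|v.1.1| + |v.1.2|) + 1 ≤ ((64 ^ k₀ : ℕ) : ℤ) := by
    obtain ⟨k, hk⟩ := pow_unbounded_of_one_lt (2 * (|v.1.1| + |v.1.2|) + 1)
      (show (1 : ℤ) < 64 by norm_num)
    exact ⟨k, by exact_mod_cast hk.le⟩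
  set n : ℕ → ℕ := fun k => 64 ^ (k + k₀) with hn
  have hn1 : ∀ k, 1 ≤ n k := fun k => Nat.one_le_pow _ _ (by norm_num)
  have hnk : ∀ k, 2 * (|v.1.1| + |v.1.2|) + 1 ≤ (n k : ℤ) := fun k =>
    hk₀.trans (by exact_mod_cast Nat.pow_le_pow_right (by norm_num) (by omega))
  have hnpos : ∀ k, (0 : ℝ) < n k := fun k => by exact_mod_cast hn1 k
  have hT : ∀ k, ∃ T, (n k : ℝ) ≤
      (Comb f).shellEnergy (box f (n k)) (box f (64 * n k)) (box f (64 * n k)) T v := fun k =>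
    (eventually_le_shellEnergy hf (by
      have := hnk k
      have := abs_nonneg v.1.1
      have := abs_nonneg v.1.2
      omega)).exists
  choose T hT using hT
  set Y : ℕ → (ℕ → CombVertex f) × (ℕ → CombVertex f) → ℝ :=
    fun k p => levelCount f (n k) (T k) p / (64 * n k) with hY
  set b : ℕ → ℝ := fun k => levelEnergy f (n k) (T k) v / (64 * n k) with hb
  have hb0 : ∀ k, 0 ≤ b k := fun k => div_nonneg (levelEnergy_nonneg _ _ _) (by positivity)
  -- The exponent is shifted by one because the outer box has radius `64 * n k`. One factor `64`
  -- comes from the low share and one from the normalisation.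
  have hlow : ∀ k, min 1 (((64 ^ (k + (k₀ + 1)) : ℕ) : ℝ) / runningMax f (64 ^ (k + (k₀ + 1)))) ≤
      4096 * b k := by
    intro k
    have hvm : v ∈ box f (n k) := mem_box.2 (by
      have := hnk k
      have := abs_nonneg v.1.1
      have := abs_nonneg v.1.2
      omega)
    have h1 := shellEnergy_le_lowBox (T k) hf (show n k ≤ 64 * n k by omega) hvm
    have h2 : 64 * n k = 64 ^ (k + (k₀ + 1)) := by
      simp only [hn]; rw [← add_assoc, pow_succ, mul_comm]
    have h3 : 0 ≤ min 1 (((64 * n k : ℕ) : ℝ) / runningMax f (64 * n k)) :=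
      le_min zero_le_one (div_nonneg (Nat.cast_nonneg _)
        (zero_le_one.trans (one_le_runningMax f _)))
    have h4 := (mul_le_mul_of_nonneg_left (hT k) h3).trans h1
    rw [← h2]
    simp only [hb, levelEnergy]
    rw [← mul_div_assoc, le_div_iff₀ (by have := hnpos k; positivity)]
    linarith
  have hbdiv : Tendsto (fun K => ∑ k ∈ Finset.range K, b k) atTop atTop := by
    have h1 := (tendsto_sum_min_runningMax hdiv (k₀ + 1)).const_mul_atTop
      (show (0 : ℝ) < 1 / 4096 by norm_num)
    refine tendsto_atTop_mono (fun K => ?_) h1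
    rw [Finset.mul_sum]
    exact Finset.sum_le_sum fun k _ => by linarith [hlow k]
  have hcov : ∀ j r, ∫ p, Y j p * Y (j + r) p ∂(μ.prod ν) ≤
      b j * b (j + r) + 7776 * b j * (1 / 2) ^ r := by
    intro j r
    have hj := hnpos j
    have hjr := hnpos (j + r)
    have h1 : ∀ p, Y j p * Y (j + r) p = levelCount f (n j) (T j) p *
        levelCount f (n (j + r)) (T (j + r)) p / ((64 * n j) * (64 * n (j + r))) := fun p => by
      simp only [hY]; rw [div_mul_div_comm]
    simp only [h1]
    rw [integral_div, div_le_iff₀ (by positivity)]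
    have hEj := levelEnergy_nonneg (n j) (T j) v
    have hEr := levelEnergy_nonneg (n (j + r)) (T (j + r)) v
    have hbj : levelEnergy f (n j) (T j) v = b j * (64 * n j) := by simp only [hb]; field_simp
    have hbr : levelEnergy f (n (j + r)) (T (j + r)) v = b (j + r) * (64 * n (j + r)) := by
      simp only [hb]; field_simp
    -- The diagonal uses the second moment bound, since `1032 / 64 ≤ 7776`; off the diagonal the
    -- error ratio is `64⁻¹ ^ r`.
    rcases Nat.eq_zero_or_pos r with rfl | hr
    · have h2 := integral_levelCount_sq_le hf hμ hν (hn1 j) (T j)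
      rw [add_zero, pow_zero]
      refine h2.trans ?_
      rw [hbj]
      have h3 := mul_nonneg (hb0 j) (mul_nonneg hj.le hj.le)
      have h4 := mul_nonneg (mul_nonneg (hb0 j) (hb0 j)) (mul_nonneg hj.le hj.le)
      linarith
    · have hpow : n (j + r) = 64 ^ r * n j := by
        simp only [hn]; rw [← pow_add]; congr 1; ring
      have h2 := integral_levelCount_mul_le hf hμ hν (hnk j) (n := n (j + r))
        (by rw [hpow]; exact Nat.mul_le_mul_right _ (Nat.le_self_pow (by omega) 64)) (T j) (T (j + r))
      refine h2.trans ?_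
      rw [hbj, hbr]
      have h5 : (n j : ℝ) ≤ (1 / 2) ^ r * n (j + r) := by
        rw [hpow]
        push_cast
        rw [← mul_assoc, ← mul_pow]
        have : (1 : ℝ) ≤ (1 / 2 * 64) ^ r := one_le_pow₀ (by norm_num)
        nlinarith
      have h6 := mul_le_mul_of_nonneg_left h5 (mul_nonneg (hb0 j) hj.le)
      linarith
  have hzero : ∀ c : ℕ, (μ.prod ν) {p | ∀ K, ∑ k ∈ Finset.range K, Y k p ≤ c} = 0 := by
    intro c
    refine measure_forall_sum_le_eq_zero (b := b) (M := 7776) ?_ ?_ ?_ hb0 (by norm_num) hcov hbdiv c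
    · exact fun k => (integrable_levelCount _ _).div_const _
    · intro j k
      have h1 : (fun p => Y j p * Y k p) = fun p => (levelCount f (n j) (T j) p *
          levelCount f (n k) (T k) p) / ((64 * n j) * (64 * n k)) := by
        funext p; simp only [hY]; rw [div_mul_div_comm]
      rw [h1]
      exact (integrable_levelCount_mul _ _ _ _).div_const _
    · intro k
      simp only [hY, hb]
      rw [integral_div, integral_levelCount hμ hν]
  rw [ae_iff]
  refine measure_mono_null ?_ (measure_iUnion_null hzero)
  intro p hp
  have hfin : {t | p.1 t = p.2 t}.Finite := Set.not_infinite.1 hp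
  refine Set.mem_iUnion.2 ⟨{t | p.1 t = p.2 t}.ncard, fun K => ?_⟩
  set c : ℝ := ({t | p.1 t = p.2 t}.ncard : ℝ) with hc
  have hc0 : 0 ≤ c := Nat.cast_nonneg _
  -- With only `c` collisions, geometric normalisation keeps every partial sum of `Y` at most `c`.
  have h1 : ∀ k ∈ Finset.range K, Y k p ≤ c / 2 * (1 / 2) ^ k := by
    intro k _
    have hk := hnpos k
    simp only [hY]
    rw [div_le_iff₀ (by positivity)]
    refine (levelCount_le_ncard _ _ hfin).trans ?_
    have h2 : (2 : ℝ) ^ k ≤ n k := by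
      simp only [hn]
      push_cast
      exact (pow_le_pow_left₀ (by norm_num) (by norm_num) k).trans
        (pow_le_pow_right₀ (by norm_num) (by omega))
    have h3 : (1 : ℝ) ≤ (1 / 2) ^ k * n k := by
      calc (1 : ℝ) = (1 / 2) ^ k * 2 ^ k := by rw [← mul_pow]; norm_num
        _ ≤ _ := by gcongr
    have h4 := mul_le_mul_of_nonneg_left h3 hc0
    linarith
  refine (Finset.sum_le_sum h1).trans ?_
  rw [← Finset.mul_sum]
  have := sum_geometric_two_le K
  nlinarith

end Comb

end Collisions

theorem theorem1p1 (f : ℤ → ℝ) (hf : ∀ i, 0 ≤ f i)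
    (hdiv : Tendsto (fun N : ℕ => ∑ n ∈ Finset.Icc 1 N, 1 / runningMax f n) atTop atTop)
    {Ω : Type*} [MeasurableSpace Ω] (P : Measure Ω) [IsProbabilityMeasure P]
    (v : CombVertex f) (X X' : ℕ → Ω → CombVertex f)
    (hX : IsSimpleRandomWalk (Comb f) P v X)
    (hX' : IsSimpleRandomWalk (Comb f) P v X')
    (hindep : IndepFun (fun ω n => X n ω) (fun ω n => X' n ω) P) :
    ∀ᵐ ω ∂P, {n : ℕ | X n ω = X' n ω}.Infinite := by
  have hm : Measurable fun ω n => X n ω := measurable_pi_lambda _ hX.measurable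
  have hm' : Measurable fun ω n => X' n ω := measurable_pi_lambda _ hX'.measurable
  have := Measure.isProbabilityMeasure_map (μ := P) hm.aemeasurable
  have := Measure.isProbabilityMeasure_map (μ := P) hm'.aemeasurable
  have key := Comb.ae_infinite_collisions hf hdiv hX.map_path hX'.map_path
  -- Independence identifies the joint law of the two paths with the product of their laws.
  rw [← (indepFun_iff_map_prod_eq_prod_map_map hm.aemeasurable hm'.aemeasurable).1 hindep] at key
  exact ae_of_ae_map (hm.prodMk hm').aemeasurable key
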